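/- Let $\mathbb{K}$ be a field, $A$ a $\mathbb{K}$-algebra, and $(A,\Omega^1,d)$ a first order differential calculus: $\Omega^1$ is an $A$-bimodule and $d:A\to\Omega^1$ is $\mathbb{K}$-linear with $d(ab)=(da)b+a\,db$. Assume that the calculus is surjective, i.e. $\Omega^1$ is spanned by the elements $a\,db$. Write $\Omega^1=\Omega^1_{\mathrm{uni}}/\mathcal N$, where $\Omega^1_{\mathrm{uni}}=\ker(A\otimes_{\mathbb K}A\to A)$ has differential $a\mapsto a\otimes 1-1\otimes a$. Then $\mathcal N$ consists of the $\sum_m r_m\otimes s_m$ with $\sum_m r_ms_m=0$ and $\sum_m(dr_m)s_m=0$. Assume that $\Omega^1$ is pivotal: there is an $A$-bimodule $\mathfrak X^1$ which is both a left and a right dual of $\Omega^1$, with chosen duality bimodule maps $$\mathrm{ev}:\mathfrak X^1\otimes_A\Omega^1\to A,\quad \mathrm{coev}:A\to\Omega^1\otimes_A\mathfrak X^1,\qquad \underline{\mathrm{ev}}:\Omega^1\otimes_A\mathfrak X^1\to A,\quad \underline{\mathrm{coev}}:A\to\mathfrak X^1\otimes_A\Omega^1,$$ each pair satisfying the zigzag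 identities. Write $\mathrm{coev}(1)=\sum_i\omega_i\otimes x'_i$ and $\underline{\mathrm{coev}}(1)=\sum_j y'_j\otimes\rho_j$. The algebra $H\mathfrak X^1$, with product $\bullet$, is the quotient of the free product $A^e\star T_{\mathbb K}\mathfrak X^1\star T_{\mathbb K}(\mathfrak X^1\otimes_{\mathbb K}\Omega^1)\star T_{\mathbb K}(\Omega^1\otimes_{\mathbb K}\mathfrak X^1)$, where $A^e=A\otimes A^{\mathrm{op}}$, with generators $a\overline{b}$, $x$, $(x,\omega)$, $(\omega,x)$, by the two-sided ideal generated by the relations $$a\bullet x=ax,\quad x\bullet a=xa+\mathrm{ev}(x\otimes da),\quad x\bullet\overline a=\overline a\bullet x+(x,da),$$ $$a\overline{a'}\bullet(x,\omega)\bullet b\overline{b'}=(axb,b'\omega a'),\quad a\overline{a'}\bullet(\omega,x)\bullet b\overline{b'}=(a\omega b,b'xa'),$$ $$\sum_i(\omega_i,x)\bullet(x'_i,\omega)=\overline{\underline{\mathrm{ev}}(\omega\otimes x)},\quad \sum_j(x,\rho_j)\bullet(\omega,y'_j)=\mathrm{ev}(x\otimes\omega),$$ $$\sum_j(y'_j,\omega)\bullet(\rho_j,x)=\overline{\mathrm{ev}(x\otimes\omega)},\quad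 \sum_i(\omega,x'_i)\bullet(x,\omega_i)=\underline{\mathrm{ev}}(\omega\otimes x).$$ As an algebra, its isotopy quotient $\mathrm{iso}(H\mathfrak X^1)$ is the quotient of $H\mathfrak X^1$ by the two-sided ideal generated by the elements $a-\overline a$, $a\in A$. Let $A_{\mathrm{ab}}=A/\langle ab-ba\rangle$, and let $\mathfrak Y^1$ be a second copy of the bimodule $\mathfrak X^1$, whose elements are written $\overline x$ as generators. Let $b_i,c_j\in A$ and $x_i,y_j\in\mathfrak X^1$ be any finite families with $\mathrm{coev}(1)=\sum_i db_i\otimes x_i$ and $\underline{\mathrm{coev}}(1)=\sum_j y_j\otimes dc_j$ (these exist because the calculus is surjective). **Proposition.** As an algebra, $\mathrm{iso}(H\mathfrak X^1)$ is isomorphic to the quotient of the free product $A_{\mathrm{ab}}\star T_{\mathbb K}\mathfrak X^1\star T_{\mathbb K}\mathfrak Y^1$ by the two-sided ideal generated by the following relations, for all $a\in A$, all $x,y\in\mathfrak X^1$ and all $\sum_m r_m\otimes s_m\in\mathcal N$ (an element $a\in A$ stands for its class in $A_{\mathrm{ab}}$, and sums over $i$ and $j$ are understood): $$a\bullet x=ax,\qquad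 x\bullet a=xa+\mathrm{ev}(x\otimes da),$$ $$a\bullet\overline y=\overline{ya},\qquad \overline y\bullet a=\overline{ay}+\underline{\mathrm{ev}}(da\otimes y),$$ $$\sum_m s_mxr_m=0=\sum_m\overline{s_mxr_m},$$ $$\overline y\bullet(b_ix_i)-\overline{yb_i}\bullet x_i=\overline y,$$ $$x\bullet\overline{y_jc_j}-(c_jx)\bullet\overline{y_j}=x,$$ $$y_j\bullet(\overline{c_jxa}-\overline{xc_ja})-(ay_j)\bullet(\overline{c_jx}-\overline{xc_j})=ax-xa,$$ $$\overline{x_ia}\bullet(xb_i-b_ix)-\overline{x_i}\bullet(axb_i-ab_ix)=\overline{ax}-\overline{xa}.$$ The isomorphism identifies the classes of $a\in A$ and of $x\in\mathfrak X^1$ on both sides, and it identifies $\overline y$ with the class of $\sum_i(\omega_i,y)\bullet x'_i$. -/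

import Mathlib

open scoped TensorProduct RightActions

universe u

noncomputable section

namespace NCG

/-! ### Bimodules and first order differential calculi

Throughout, an `A`-bimodule is a `K`-vector space with commuting actions of `A` and `Aᵐᵒᵖ` that are
both compatible with the action of `K`; `m <• a` is the right action. -/

section Bimodules

set_option linter.unusedSectionVars false

variable (K A : Type u) [Field K] [Ring A] [Algebra K A]
variable (M : Type u) [AddCommGroup M] [Module K M] [Module A M] [Module Aᵐᵒᵖ M]
variable (N : Type u) [AddCommGroup N] [Module K N] [Module A N] [Module Aᵐᵒᵖ N]

/-- The subspace of `M ⊗[K] N` spanned by the elements `m a ⊗ n - m ⊗ a n`. -/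
def balancing : Submodule K (M ⊗[K] N) :=
  Submodule.span K {t | ∃ (m : M) (a : A) (n : N), t = (m <• a) ⊗ₜ[K] n - m ⊗ₜ[K] (a • n)}

/-- The tensor product `M ⊗_A N` of a right and a left module over the noncommutative algebra `A`,
as a `K`-vector space. -/
abbrev BalTensor : Type u := (M ⊗[K] N) ⧸ balancing K A M N

variable {M N}

/-- The class of `m ⊗ n` in `M ⊗_A N`. -/
def btmul (m : M) (n : N) : BalTensor K A M N := (balancing K A M N).mkQ (m ⊗ₜ[K] n)

theorem btmul_balanced (m : M) (a : A) (n : N) :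
    btmul K A (m <• a) n = btmul K A m (a • n) := by
  unfold btmul
  rw [← sub_eq_zero, ← map_sub, Submodule.mkQ_apply, Submodule.Quotient.mk_eq_zero]
  exact Submodule.subset_span ⟨m, a, n, rfl⟩

theorem btmul_sum_left {n : ℕ} (f : Fin n → M) (y : N) :
    btmul K A (∑ i, f i) y = ∑ i, btmul K A (f i) y := by
  simp only [btmul, TensorProduct.sum_tmul, map_sum]

theorem btmul_sum_right {n : ℕ} (x : M) (f : Fin n → N) :
    btmul K A x (∑ i, f i) = ∑ i, btmul K A x (f i) := by
  simp only [btmul, TensorProduct.tmul_sum, map_sum]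

variable (M N)

/-- A duality in the monoidal category of `A`-bimodules, with evaluation `M ⊗_A N → A` and
coevaluation `A → N ⊗_A M`. The evaluation is given as a balanced bilinear map, and the
coevaluation by a representative `∑ i, right i ⊗ left i` of the image of `1`, which determines it;
that this image is central in `N ⊗_A M`, so that `1 ↦ ∑ i, right i ⊗ left i` does extend to a
bimodule map, follows from the two zigzag identities (see `BimoduleDuality.coev_central`). -/
structure BimoduleDuality where
  ev : M →ₗ[K] N →ₗ[K] A
  ev_balanced : ∀ (m : M) (a : A) (n : N), ev (m <• a) n = ev m (a • n)
  ev_left : ∀ (a : A) (m : M) (n : N), ev (a • m) n = a * ev m n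
  ev_right : ∀ (m : M) (n : N) (a : A), ev m (n <• a) = ev m n * a
  size : ℕ
  right : Fin size → N
  left : Fin size → M
  zigzag_left : ∀ m : M, ∑ i, ev m (right i) • left i = m
  zigzag_right : ∀ n : N, ∑ i, right i <• ev (left i) n = n

variable {K A M N}

/-- The element `coev(1)` of `N ⊗_A M`. -/
def BimoduleDuality.coevOne (D : BimoduleDuality K A M N) : BalTensor K A N M :=
  ∑ i, btmul K A (D.right i) (D.left i)

theorem BimoduleDuality.coev_central (D : BimoduleDuality K A M N) (a : A) :
    ∑ i, btmul K A (a • D.right i) (D.left i) = ∑ i, btmul K A (D.right i) (D.left i <• a) := by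
  have h1 : ∀ i, btmul K A (a • D.right i) (D.left i) =
      ∑ k, btmul K A (D.right k) (D.ev (D.left k <• a) (D.right i) • D.left i) := by
    intro i
    conv_lhs => rw [← D.zigzag_right (a • D.right i)]
    rw [btmul_sum_left]
    exact Finset.sum_congr rfl fun k _ => by rw [btmul_balanced, D.ev_balanced]
  simp only [h1]
  rw [Finset.sum_comm]
  refine Finset.sum_congr rfl fun k _ => ?_
  rw [← btmul_sum_right, D.zigzag_left]

end Bimodules

section Calculus

variable (K A : Type u) [Field K] [Ring A] [Algebra K A]
variable (Ω : Type u) [AddCommGroup Ω] [Module K Ω] [Module A Ω] [Module Aᵐᵒᵖ Ω]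
variable (X : Type u) [AddCommGroup X] [Module K X] [Module A X] [Module Aᵐᵒᵖ X]

/-- A first order differential calculus on `A` with bimodule of one-forms `Ω`. -/
structure Calculus where
  d : A →ₗ[K] Ω
  leibniz : ∀ a b : A, d (a * b) = d a <• b + a • d b

/-- A pivotal structure on `Ω`: the bimodule `X` of vector fields is both a left and a right dual
of `Ω`, with chosen duality morphisms. In the notation
`coev(1) = ∑ i, ω i ⊗ x i` and `coev'(1) = ∑ j, y j ⊗ ρ j`, we have
`ω = evl.right`, `x = evl.left`, `y = evr.right`, `ρ = evr.left`. -/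
structure Pivotal where
  evl : BimoduleDuality K A X Ω
  evr : BimoduleDuality K A Ω X

variable {K A Ω}

/-- The calculus is surjective: `Ω` is spanned by the elements `a db`. -/
def Calculus.Surjective (C : Calculus K A Ω) : Prop :=
  Submodule.span K {w : Ω | ∃ a b : A, w = a • C.d b} = ⊤

/-- The linear map `A ⊗ A → Ω`, `r ⊗ s ↦ (dr) s`. Restricted to the universal calculus
`ker (mul : A ⊗ A → A)`, whose differential is `a ↦ a ⊗ 1 - 1 ⊗ a`, it is the unique bimodule map to
`Ω` that commutes with the differentials. -/
def Calculus.fromTensor [IsScalarTower K Aᵐᵒᵖ Ω] (C : Calculus K A Ω) : A ⊗[K] A →ₗ[K] Ω :=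
  TensorProduct.lift <| LinearMap.mk₂ K (fun r s : A => C.d r <• s)
    (fun r r' s => by simp only [map_add, smul_add])
    (fun k r s => by rw [map_smul, smul_comm])
    (fun r s s' => by simp only [MulOpposite.op_add, add_smul])
    (fun k r s => by rw [MulOpposite.op_smul, smul_assoc])

/-- The sub-bimodule `N` of the universal calculus with `Ω = Ω_uni / N`: the kernel of the map from
the universal calculus to `Ω`. -/
def Calculus.kernel [IsScalarTower K Aᵐᵒᵖ Ω] (C : Calculus K A Ω) : Submodule K (A ⊗[K] A) :=
  LinearMap.ker (LinearMap.mul' K A) ⊓ LinearMap.ker C.fromTensor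

end Calculus

/-! ### The algebra of adaptable bimodule connections -/

section HAlgebra

variable (K A : Type u) [Field K] [Ring A] [Algebra K A]
variable (Ω : Type u) [AddCommGroup Ω] [Module K Ω] [Module A Ω] [Module Aᵐᵒᵖ Ω]
variable (X : Type u) [AddCommGroup X] [Module K X] [Module A X] [Module Aᵐᵒᵖ X]

/-- Labels of the four factors of the free product that generates `H𝔛`. -/
inductive HIndex : Type
  | base | vec | vecForm | formVec
  deriving DecidableEq

/-- The four factors: `A^e = A ⊗ Aᵒᵖ` and the tensor algebras of `X`, `X ⊗ Ω` and `Ω ⊗ X`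
over `K`. -/
abbrev HFactor : HIndex → Type u
  | .base => A ⊗[K] Aᵐᵒᵖ
  | .vec => TensorAlgebra K X
  | .vecForm => TensorAlgebra K (X ⊗[K] Ω)
  | .formVec => TensorAlgebra K (Ω ⊗[K] X)

instance HFactor.instRing : ∀ i, Ring (HFactor K A Ω X i)
  | .base => inferInstanceAs (Ring (A ⊗[K] Aᵐᵒᵖ))
  | .vec => inferInstanceAs (Ring (TensorAlgebra K X))
  | .vecForm => inferInstanceAs (Ring (TensorAlgebra K (X ⊗[K] Ω)))
  | .formVec => inferInstanceAs (Ring (TensorAlgebra K (Ω ⊗[K] X)))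

instance HFactor.instAlgebra : ∀ i, Algebra K (HFactor K A Ω X i)
  | .base => inferInstanceAs (Algebra K (A ⊗[K] Aᵐᵒᵖ))
  | .vec => inferInstanceAs (Algebra K (TensorAlgebra K X))
  | .vecForm => inferInstanceAs (Algebra K (TensorAlgebra K (X ⊗[K] Ω)))
  | .formVec => inferInstanceAs (Algebra K (TensorAlgebra K (Ω ⊗[K] X)))

/-- The free product `A^e ⋆ T X ⋆ T (X ⊗ Ω) ⋆ T (Ω ⊗ X)`. -/
abbrev HFree : Type u := LinearAlgebra.FreeProduct K (HFactor K A Ω X)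

namespace HFree

/-- `a ↦ a ⊗ 1`, as a map into the free product. -/
def src : A →ₐ[K] HFree K A Ω X :=
  (LinearAlgebra.FreeProduct.ι K (HFactor K A Ω X) .base).comp
    (Algebra.TensorProduct.includeLeft : A →ₐ[K] A ⊗[K] Aᵐᵒᵖ)

/-- `ā ↦ 1 ⊗ ā`, as a map into the free product. -/
def tgt : Aᵐᵒᵖ →ₐ[K] HFree K A Ω X :=
  (LinearAlgebra.FreeProduct.ι K (HFactor K A Ω X) .base).comp
    (Algebra.TensorProduct.includeRight : Aᵐᵒᵖ →ₐ[K] A ⊗[K] Aᵐᵒᵖ)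

variable {Ω X}

/-- The generator `x`. -/
def vec (x : X) : HFree K A Ω X :=
  LinearAlgebra.FreeProduct.ι K (HFactor K A Ω X) .vec (TensorAlgebra.ι K x)

/-- The generator `(x, ω)`. -/
def vecForm (x : X) (w : Ω) : HFree K A Ω X :=
  LinearAlgebra.FreeProduct.ι K (HFactor K A Ω X) .vecForm (TensorAlgebra.ι K (x ⊗ₜ[K] w))

/-- The generator `(ω, x)`. -/
def formVec (w : Ω) (x : X) : HFree K A Ω X :=
  LinearAlgebra.FreeProduct.ι K (HFactor K A Ω X) .formVec (TensorAlgebra.ι K (w ⊗ₜ[K] x))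

end HFree

variable {K A Ω X}

open HFree MulOpposite in
/-- The defining relations of `H𝔛`. -/
inductive HRel (C : Calculus K A Ω) (P : Pivotal K A Ω X) : HFree K A Ω X → HFree K A Ω X → Prop
  | left_mul (a : A) (x : X) :
      HRel C P (src K A Ω X a * vec K A x) (vec K A (a • x))
  | right_mul (a : A) (x : X) :
      HRel C P (vec K A x * src K A Ω X a) (vec K A (x <• a) + src K A Ω X (P.evl.ev x (C.d a)))
  | bar_mul (a : A) (x : X) :
      HRel C P (vec K A x * tgt K A Ω X (op a))
        (tgt K A Ω X (op a) * vec K A x + vecForm K A x (C.d a))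
  | vecForm_bimod (a a' b b' : A) (x : X) (w : Ω) :
      HRel C P
        (src K A Ω X a * tgt K A Ω X (op a') * vecForm K A x w
          * (src K A Ω X b * tgt K A Ω X (op b')))
        (vecForm K A (a • x <• b) (b' • w <• a'))
  | formVec_bimod (a a' b b' : A) (w : Ω) (x : X) :
      HRel C P
        (src K A Ω X a * tgt K A Ω X (op a') * formVec K A w x
          * (src K A Ω X b * tgt K A Ω X (op b')))
        (formVec K A (a • w <• b) (b' • x <• a'))
  | inv_left (x : X) (w : Ω) :
      HRel C P (∑ i, formVec K A (P.evl.right i) x * vecForm K A (P.evl.left i) w)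
        (tgt K A Ω X (op (P.evr.ev w x)))
  | inv_right (x : X) (w : Ω) :
      HRel C P (∑ j, vecForm K A x (P.evr.left j) * formVec K A w (P.evr.right j))
        (src K A Ω X (P.evl.ev x w))
  | hopf_left (x : X) (w : Ω) :
      HRel C P (∑ j, vecForm K A (P.evr.right j) w * formVec K A (P.evr.left j) x)
        (tgt K A Ω X (op (P.evl.ev x w)))
  | hopf_right (x : X) (w : Ω) :
      HRel C P (∑ i, formVec K A w (P.evl.left i) * vecForm K A x (P.evl.right i))
        (src K A Ω X (P.evr.ev w x))

/-- The algebra `H𝔛` of a first order calculus with a pivotal structure: the quotient of the free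
product by the two-sided ideal that the relations generate. -/
abbrev HAlg (C : Calculus K A Ω) (P : Pivotal K A Ω X) : Type u := RingQuot (HRel C P)

namespace HAlg

variable (C : Calculus K A Ω) (P : Pivotal K A Ω X)

/-- The source map `A → H𝔛`. -/
def source : A →ₐ[K] HAlg C P := (RingQuot.mkAlgHom K (HRel C P)).comp (HFree.src K A Ω X)

/-- The target map `Aᵒᵖ → H𝔛`. -/
def target : Aᵐᵒᵖ →ₐ[K] HAlg C P := (RingQuot.mkAlgHom K (HRel C P)).comp (HFree.tgt K A Ω X)

/-- The class of the generator `x` in `H𝔛`. -/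
def vec (x : X) : HAlg C P := RingQuot.mkAlgHom K (HRel C P) (HFree.vec K A x)

/-- The class of the generator `(x, ω)` in `H𝔛`. -/
def vecForm (x : X) (w : Ω) : HAlg C P :=
  RingQuot.mkAlgHom K (HRel C P) (HFree.vecForm K A x w)

/-- The class of the generator `(ω, x)` in `H𝔛`. -/
def formVec (w : Ω) (x : X) : HAlg C P :=
  RingQuot.mkAlgHom K (HRel C P) (HFree.formVec K A w x)

end HAlg

end HAlgebra

/-! ### Abelianisation and isotopy quotient -/

section Isotopy

variable (K : Type u) [Field K] (A : Type u) [Ring A] [Algebra K A]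

/-- `ab ~ ba`. -/
inductive AbRel : A → A → Prop
  | swap (a b : A) : AbRel (a * b) (b * a)

/-- The abelianisation of `A`: the quotient by the two-sided ideal generated by the elements
`ab - ba`. -/
abbrev Ab : Type u := RingQuot (AbRel A)

/-- The projection of `A` onto its abelianisation. -/
def Ab.mk : A →ₐ[K] Ab A := RingQuot.mkAlgHom K (AbRel A)

variable {K A} {H : Type u} [Ring H] [Algebra K H]

/-- `s(a) ~ t(a)`. -/
inductive IsoRel (s : A →ₐ[K] H) (t : Aᵐᵒᵖ →ₐ[K] H) : H → H → Prop
  | eq (a : A) : IsoRel s t (s a) (t (MulOpposite.op a))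

/-- The total algebra of the isotopy quotient of `(A, H)` with source `s` and target `t`: the
quotient of `H` by the two-sided ideal generated by the elements `s(a) - t(a)`. -/
abbrev IsotopyQuotient (s : A →ₐ[K] H) (t : Aᵐᵒᵖ →ₐ[K] H) : Type u := RingQuot (IsoRel s t)

/-- The projection of `H` onto its isotopy quotient. -/
def IsotopyQuotient.mk (s : A →ₐ[K] H) (t : Aᵐᵒᵖ →ₐ[K] H) : H →ₐ[K] IsotopyQuotient s t :=
  RingQuot.mkAlgHom K (IsoRel s t)

end Isotopy

/-! ### The presentation by generators `A_ab`, `X` and a second copy of `X` -/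

section Presentation

variable (K A : Type u) [Field K] [Ring A] [Algebra K A]
variable (Ω : Type u) [AddCommGroup Ω] [Module K Ω] [Module A Ω] [Module Aᵐᵒᵖ Ω]
variable (X : Type u) [AddCommGroup X] [Module K X] [Module A X] [Module Aᵐᵒᵖ X]

/-- Labels of the three factors of the free product `A_ab ⋆ T X ⋆ T X`. -/
inductive QIndex : Type
  | base | vec | bar
  deriving DecidableEq

/-- The three factors: the abelianisation of `A` and two copies of the tensor algebra of `X`. -/
abbrev QFactor : QIndex → Type u
  | .base => Ab A
  | .vec => TensorAlgebra K X
  | .bar => TensorAlgebra K X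

instance QFactor.instRing : ∀ i, Ring (QFactor K A X i)
  | .base => inferInstanceAs (Ring (Ab A))
  | .vec => inferInstanceAs (Ring (TensorAlgebra K X))
  | .bar => inferInstanceAs (Ring (TensorAlgebra K X))

instance QFactor.instAlgebra : ∀ i, Algebra K (QFactor K A X i)
  | .base => inferInstanceAs (Algebra K (Ab A))
  | .vec => inferInstanceAs (Algebra K (TensorAlgebra K X))
  | .bar => inferInstanceAs (Algebra K (TensorAlgebra K X))

/-- The free product `A_ab ⋆ T X ⋆ T X`. -/
abbrev QFree : Type u := LinearAlgebra.FreeProduct K (QFactor K A X)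

namespace QFree

/-- The inclusion of `A_ab`. -/
def base : Ab A →ₐ[K] QFree K A X := LinearAlgebra.FreeProduct.ι K (QFactor K A X) .base

/-- The image of `a ∈ A`, through its class in `A_ab`. -/
def scal (a : A) : QFree K A X := base K A X (Ab.mk K A a)

variable {X}

/-- The generator `x`. -/
def vec (x : X) : QFree K A X :=
  LinearAlgebra.FreeProduct.ι K (QFactor K A X) .vec (TensorAlgebra.ι K x)

/-- The generator `x̄`, in the second copy of `X`. -/
def bar (x : X) : QFree K A X :=
  LinearAlgebra.FreeProduct.ι K (QFactor K A X) .bar (TensorAlgebra.ι K x)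

end QFree

variable {K A Ω X}

open QFree in
/-- The relations of the presentation of the isotopy quotient, for elements `b i`, `x i`, `y j` and
`c j` with `coev(1) = ∑ i, d (b i) ⊗ x i` and `coev'(1) = ∑ j, y j ⊗ d (c j)`. -/
inductive QRel [IsScalarTower K Aᵐᵒᵖ Ω] (C : Calculus K A Ω) (P : Pivotal K A Ω X)
    {p q : ℕ} (b : Fin p → A) (x : Fin p → X) (y : Fin q → X) (c : Fin q → A) :
    QFree K A X → QFree K A X → Prop
  | left_mul (a : A) (v : X) :
      QRel C P b x y c (scal K A X a * vec K A v) (vec K A (a • v))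
  | right_mul (a : A) (v : X) :
      QRel C P b x y c (vec K A v * scal K A X a)
        (vec K A (v <• a) + scal K A X (P.evl.ev v (C.d a)))
  | bar_left_mul (a : A) (v : X) :
      QRel C P b x y c (scal K A X a * bar K A v) (bar K A (v <• a))
  | bar_right_mul (a : A) (v : X) :
      QRel C P b x y c (bar K A v * scal K A X a)
        (bar K A (a • v) + scal K A X (P.evr.ev (C.d a) v))
  | bim (n : ℕ) (r s : Fin n → A) (_ : ∑ m, r m ⊗ₜ[K] s m ∈ C.kernel) (v : X) :
      QRel C P b x y c (∑ m, vec K A (s m • v <• r m)) 0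
  | bar_bim (n : ℕ) (r s : Fin n → A) (_ : ∑ m, r m ⊗ₜ[K] s m ∈ C.kernel) (v : X) :
      QRel C P b x y c (∑ m, bar K A (s m • v <• r m)) 0
  | inv_left (v : X) :
      QRel C P b x y c
        (∑ i, (bar K A v * vec K A (b i • x i) - bar K A (v <• b i) * vec K A (x i)))
        (bar K A v)
  | inv_right (v : X) :
      QRel C P b x y c
        (∑ j, (vec K A v * bar K A (y j <• c j) - vec K A (c j • v) * bar K A (y j)))
        (vec K A v)
  | hopf_left (a : A) (v : X) :
      QRel C P b x y c
        (∑ j, (vec K A (y j) * (bar K A (c j • v <• a) - bar K A (v <• (c j * a)))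
          - vec K A (a • y j) * (bar K A (c j • v) - bar K A (v <• c j))))
        (vec K A (a • v) - vec K A (v <• a))
  | hopf_right (a : A) (v : X) :
      QRel C P b x y c
        (∑ i, (bar K A (x i <• a) * (vec K A (v <• b i) - vec K A (b i • v))
          - bar K A (x i) * (vec K A (a • v <• b i) - vec K A ((a * b i) • v))))
        (bar K A (a • v) - bar K A (v <• a))

/-- The quotient of `A_ab ⋆ T X ⋆ T X` by the two-sided ideal that the relations generate. -/
abbrev QAlg [IsScalarTower K Aᵐᵒᵖ Ω] (C : Calculus K A Ω) (P : Pivotal K A Ω X)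
    {p q : ℕ} (b : Fin p → A) (x : Fin p → X) (y : Fin q → X) (c : Fin q → A) : Type u :=
  RingQuot (QRel C P b x y c)

/-- The projection of the free product onto the quotient. -/
def QAlg.mk [IsScalarTower K Aᵐᵒᵖ Ω] (C : Calculus K A Ω) (P : Pivotal K A Ω X)
    {p q : ℕ} (b : Fin p → A) (x : Fin p → X) (y : Fin q → X) (c : Fin q → A) :
    QFree K A X →ₐ[K] QAlg C P b x y c :=
  RingQuot.mkAlgHom K (QRel C P b x y c)

end Presentation

end NCG

end

/-! In the isotopy quotient source and target agree, so the copies of `A` and `Aᵐᵒᵖ`, which commute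
in `A^e`, merge into a commutative image of `A`. The relation `x • ā = ā • x + (x, da)` then says
that `(x, da)` is the commutator `[x, a]`. Setting `ȳ = ∑ (ω_i, y) • x'_i`, centrality of the
coevaluation and a zigzag identity give `[ȳ, a] = (da, y)`. Since one-forms are spanned by the
`(dr)s`, the generators `(x, ω)` and `(ω, x)` are redundant, with `(x, (dr)s) = s[x, r]` and
`((dr)s, y) = [ȳ, r]s`.

These formulas are well defined on `Ω` exactly because of the two relations indexed by `𝒩`. The
remaining four relations of the presentation are the four invertibility relations of `H𝔛`, written
out in commutators with coevaluations of the form `∑ db_i ⊗ x_i` and `∑ y_j ⊗ dc_j`.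

To use this in both directions, the two sets of relations are read as conditions on maps into an
arbitrary algebra: `IsIsotopyModel` and `IsPresentationModel`. `IsIsotopyModel.isPresentationModel`
and `IsPresentationModel.isIsotopyModel` translate one into the other. Applied to the tautological
models, the universal properties yield two algebra maps, which are mutually inverse because they are
so on generators. -/

namespace NCG

set_option linter.unusedSectionVars false

section

/-! ### Balanced maps and representatives of tensors over `A` -/

section Balanced

variable {K A M N V : Type u} [Field K] [Ring A] [Algebra K A]
  [AddCommGroup M] [Module K M] [Module A M] [Module Aᵐᵒᵖ M]
  [AddCommGroup N] [Module K N] [Module A N] [Module Aᵐᵒᵖ N]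
  [AddCommGroup V] [Module K V]

/-- A balanced bilinear map depends only on the class of a tensor in `M ⊗_A N`. -/
theorem sum_eq_of_btmul_sum_eq (β : M →ₗ[K] N →ₗ[K] V)
    (hβ : ∀ (m : M) (a : A) (n : N), β (m <• a) n = β m (a • n)) {p q : ℕ}
    {f : Fin p → M} {g : Fin p → N} {f' : Fin q → M} {g' : Fin q → N}
    (h : ∑ i, btmul K A (f i) (g i) = ∑ j, btmul K A (f' j) (g' j)) :
    ∑ i, β (f i) (g i) = ∑ j, β (f' j) (g' j) := by
  have hle : balancing K A M N ≤ LinearMap.ker (TensorProduct.lift β) := by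
    refine Submodule.span_le.2 ?_
    rintro _ ⟨m, a, n, rfl⟩
    simp [hβ]
  have := congrArg ((balancing K A M N).liftQ (TensorProduct.lift β) hle) h
  simpa [btmul] using this

variable {B : Type u} [Ring B] [Algebra K B]

theorem sum_mul_eq_of_btmul_sum_eq (f₁ : M →ₗ[K] B) (f₂ : N →ₗ[K] B)
    (h₁₂ : ∀ (m : M) (a : A) (n : N), f₁ (m <• a) * f₂ n = f₁ m * f₂ (a • n)) {p q : ℕ}
    {f : Fin p → M} {g : Fin p → N} {f' : Fin q → M} {g' : Fin q → N}
    (h : ∑ i, btmul K A (f i) (g i) = ∑ j, btmul K A (f' j) (g' j)) :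
    ∑ i, f₁ (f i) * f₂ (g i) = ∑ j, f₁ (f' j) * f₂ (g' j) :=
  sum_eq_of_btmul_sum_eq ((LinearMap.mul K B).compl₁₂ f₁ f₂) h₁₂ h

end Balanced

/-! ### One-forms as a quotient of `A ⊗ A` -/

section Calculus

variable {K A Ω V : Type u} [Field K] [Ring A] [Algebra K A]
  [AddCommGroup Ω] [Module K Ω] [Module A Ω] [Module Aᵐᵒᵖ Ω]
  [AddCommGroup V] [Module K V] (C : Calculus K A Ω)

theorem Calculus.d_one : C.d 1 = 0 := by
  simpa using C.leibniz 1 1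

theorem Calculus.smul_d (a b : A) : a • C.d b = C.d (a * b) - C.d a <• b := by
  rw [C.leibniz]; abel

variable {C}

variable [IsScalarTower K Aᵐᵒᵖ Ω]

@[simp]
theorem Calculus.fromTensor_tmul (C : Calculus K A Ω) (r s : A) :
    C.fromTensor (r ⊗ₜ[K] s) = C.d r <• s := rfl

/-- The Leibniz rule turns `a db` into `d(ab) - (da)b`, so right multiples of differentials span as
well. -/
theorem Calculus.Surjective.fromTensor_surjective (hC : C.Surjective) :
    Function.Surjective C.fromTensor := by
  rw [← LinearMap.range_eq_top, eq_top_iff, ← hC]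
  refine Submodule.span_le.2 ?_
  rintro _ ⟨a, b, rfl⟩
  exact ⟨(a * b) ⊗ₜ 1 - a ⊗ₜ b, by simp [C.smul_d]⟩

/-- Additivity is enough because every one-form is a finite sum of elements `(dr)s`. Plain functions
are allowed so that expressions involving the `A`-actions need not be bundled as linear maps. -/
theorem Calculus.Surjective.ext_d_smul (hC : C.Surjective) {f g : Ω → V}
    (hf : ∀ w w', f (w + w') = f w + f w') (hg : ∀ w w', g (w + w') = g w + g w')
    (h : ∀ r s : A, f (C.d r <• s) = g (C.d r <• s)) (w : Ω) : f w = g w := by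
  obtain ⟨t, rfl⟩ := hC.fromTensor_surjective w
  induction t with
  -- The zero form is `(d1)1`.
  | zero => simpa [C.d_one] using h 1 1
  | tmul r s => exact h r s
  | add t t' ht ht' => rw [map_add, hf, hg, ht, ht']

theorem Calculus.Surjective.ext_smul_d (hC : C.Surjective) {f g : Ω → V}
    (hf : ∀ w w', f (w + w') = f w + f w') (hg : ∀ w w', g (w + w') = g w + g w')
    (h : ∀ r s : A, f (s • C.d r) = g (s • C.d r)) (w : Ω) : f w = g w := by
  refine hC.ext_d_smul hf hg (fun r s => ?_) w
  -- Agreement on `r ds` and on `1 d(rs)` forces agreement on their difference `(dr)s`.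
  have h1 : C.d r <• s + r • C.d s = (1 : A) • C.d (r * s) := by rw [← C.leibniz, one_smul]
  have h2 := h (r * s) 1
  rw [← h1, hf, hg, h] at h2
  exact add_right_cancel h2

/-- A linear map on `A ⊗ A` that kills `1 ⊗ A` and the sub-bimodule defining the calculus factors
through the space of one-forms. -/
theorem Calculus.Surjective.exists_factor (hC : C.Surjective) (T : A ⊗[K] A →ₗ[K] V)
    (hone : ∀ s : A, T (1 ⊗ₜ s) = 0)
    (hker : ∀ (n : ℕ) (r s : Fin n → A), ∑ m, r m ⊗ₜ[K] s m ∈ C.kernel →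
      ∑ m, T (r m ⊗ₜ s m) = 0) :
    ∃ F : Ω →ₗ[K] V, ∀ r s : A, F (C.d r <• s) = T (r ⊗ₜ s) := by
  have hT : ∀ t ∈ C.kernel, T t = 0 := by
    intro t ht
    obtain ⟨n, r, s, rfl⟩ := TensorProduct.exists_sum_tmul_eq t
    rw [map_sum]
    exact hker _ _ _ ht
  have hle : LinearMap.ker C.fromTensor ≤ LinearMap.ker T := by
    intro t ht
    -- The correction `1 ⊗ mul(t)` moves `t` into the universal calculus. It changes neither the
    -- image in `Ω`, as `d1 = 0`, nor the value of `T`, by `hone`.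
    have h1 : t - 1 ⊗ₜ LinearMap.mul' K A t ∈ C.kernel := by
      refine ⟨?_, ?_⟩
      · simp
      · have : C.fromTensor t = 0 := ht
        simp [this, C.d_one]
    have h2 := hT _ h1
    rw [map_sub, hone, sub_zero] at h2
    exact h2
  let e := C.fromTensor.quotKerEquivOfSurjective hC.fromTensor_surjective
  refine ⟨(LinearMap.ker C.fromTensor).liftQ T hle ∘ₗ e.symm.toLinearMap, fun r s => ?_⟩
  have : e.symm (C.d r <• s) = (LinearMap.ker C.fromTensor).mkQ (r ⊗ₜ s) := by
    rw [LinearEquiv.symm_apply_eq]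
    rfl
  simp [this]

end Calculus

/-! ### The two sets of relations in an arbitrary algebra -/

section Models

variable {K A Ω X : Type u} [Field K] [Ring A] [Algebra K A]
  [AddCommGroup Ω] [Module K Ω] [Module A Ω] [Module Aᵐᵒᵖ Ω]
  [AddCommGroup X] [Module K X] [Module A X] [Module Aᵐᵒᵖ X]
  (C : Calculus K A Ω) (P : Pivotal K A Ω X)
  {B : Type u} [Ring B] [Algebra K B]

/-- Images of `A`, `x`, `(x, ω)` and `(ω, x)` in an algebra that satisfy the relations of the
isotopy quotient of `H𝔛`. -/
structure IsIsotopyModel (σ : A →ₐ[K] B) (u : X →ₗ[K] B) (F : X →ₗ[K] Ω →ₗ[K] B)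
    (G : Ω →ₗ[K] X →ₗ[K] B) : Prop where
  comm : ∀ a b, σ a * σ b = σ b * σ a
  left_mul : ∀ a v, σ a * u v = u (a • v)
  right_mul : ∀ a v, u v * σ a = u (v <• a) + σ (P.evl.ev v (C.d a))
  bar_mul : ∀ a v, u v * σ a = σ a * u v + F v (C.d a)
  vecForm_smul_left : ∀ a v w, F (a • v) w = σ a * F v w
  vecForm_op_smul_left : ∀ a v w, F (v <• a) w = F v w * σ a
  vecForm_smul_right : ∀ a v w, F v (a • w) = F v w * σ a
  vecForm_op_smul_right : ∀ a v w, F v (w <• a) = σ a * F v w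
  formVec_smul_left : ∀ a w v, G (a • w) v = σ a * G w v
  formVec_op_smul_left : ∀ a w v, G (w <• a) v = G w v * σ a
  formVec_smul_right : ∀ a w v, G w (a • v) = G w v * σ a
  formVec_op_smul_right : ∀ a w v, G w (v <• a) = σ a * G w v
  inv_left : ∀ v w, ∑ i, G (P.evl.right i) v * F (P.evl.left i) w = σ (P.evr.ev w v)
  inv_right : ∀ v w, ∑ j, F v (P.evr.left j) * G w (P.evr.right j) = σ (P.evl.ev v w)
  hopf_left : ∀ v w, ∑ j, F (P.evr.right j) w * G (P.evr.left j) v = σ (P.evl.ev v w)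
  hopf_right : ∀ v w, ∑ i, G w (P.evl.left i) * F v (P.evl.right i) = σ (P.evr.ev w v)

/-- Images of `A`, `x` and `x̄` in an algebra that satisfy the relations of `QAlg`. -/
structure IsPresentationModel [IsScalarTower K Aᵐᵒᵖ Ω] {p q : ℕ} (b : Fin p → A) (x : Fin p → X)
    (y : Fin q → X) (c : Fin q → A) (σ : A →ₐ[K] B) (u w : X →ₗ[K] B) : Prop where
  comm : ∀ a b, σ a * σ b = σ b * σ a
  left_mul : ∀ a v, σ a * u v = u (a • v)
  right_mul : ∀ a v, u v * σ a = u (v <• a) + σ (P.evl.ev v (C.d a))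
  bar_left_mul : ∀ a v, σ a * w v = w (v <• a)
  bar_right_mul : ∀ a v, w v * σ a = w (a • v) + σ (P.evr.ev (C.d a) v)
  bim : ∀ (n : ℕ) (r s : Fin n → A), ∑ m, r m ⊗ₜ[K] s m ∈ C.kernel → ∀ v,
    ∑ m, u (s m • v <• r m) = 0
  bar_bim : ∀ (n : ℕ) (r s : Fin n → A), ∑ m, r m ⊗ₜ[K] s m ∈ C.kernel → ∀ v,
    ∑ m, w (s m • v <• r m) = 0
  inv_left : ∀ v, ∑ i, (w v * u (b i • x i) - w (v <• b i) * u (x i)) = w v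
  inv_right : ∀ v, ∑ j, (u v * w (y j <• c j) - u (c j • v) * w (y j)) = u v
  hopf_left : ∀ a v, ∑ j, (u (y j) * (w (c j • v <• a) - w (v <• (c j * a)))
    - u (a • y j) * (w (c j • v) - w (v <• c j))) = u (a • v) - u (v <• a)
  hopf_right : ∀ a v, ∑ i, (w (x i <• a) * (u (v <• b i) - u (b i • v))
    - w (x i) * (u (a • v <• b i) - u ((a * b i) • v))) = w (a • v) - w (v <• a)

end Models

end

section

/-! ### Zigzag identities for arbitrary representatives of the coevaluation -/

section Duality

variable {K A M N B : Type u} [Field K] [Ring A] [Algebra K A]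
  [AddCommGroup M] [Module K M] [Module A M] [Module Aᵐᵒᵖ M]
  [AddCommGroup N] [Module K N] [Module A N] [Module Aᵐᵒᵖ N]
  [Ring B] [Algebra K B] {σ : A →ₐ[K] B} (D : BimoduleDuality K A M N)

theorem BimoduleDuality.sum_mul_ev_of_coevOne {n : ℕ} {f : Fin n → N} {g : Fin n → M}
    (h : ∑ i, btmul K A (f i) (g i) = D.coevOne) {φ : N →ₗ[K] B}
    (hφ : ∀ v a, φ (v <• a) = φ v * σ a) (v : N) :
    ∑ i, φ (f i) * σ (D.ev (g i) v) = φ v := by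
  have := sum_mul_eq_of_btmul_sum_eq φ (σ.toLinearMap ∘ₗ D.ev.flip v) (fun m a n => by
    simp [hφ, D.ev_left, mul_assoc]) h
  simp only [LinearMap.comp_apply, LinearMap.flip_apply, AlgHom.toLinearMap_apply] at this
  rw [this]
  simp only [← hφ]
  rw [← map_sum, D.zigzag_right]

/-- The other zigzag identity. Here the scalar from `f i` lands to the right of the evaluation and
the one from `g i` to its left, so balancedness needs the image of `A` to be commutative. -/
theorem BimoduleDuality.sum_mul_ev_of_coevOne' (hσ : ∀ a b, σ a * σ b = σ b * σ a)
    {n : ℕ} {f : Fin n → N} {g : Fin n → M}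
    (h : ∑ i, btmul K A (f i) (g i) = D.coevOne) {φ : M →ₗ[K] B}
    (hφ : ∀ v (a : A), φ (a • v) = φ v * σ a) (v : M) :
    ∑ i, φ (g i) * σ (D.ev v (f i)) = φ v := by
  have := sum_eq_of_btmul_sum_eq
    ((LinearMap.mul K B).compl₁₂ φ (σ.toLinearMap ∘ₗ D.ev v)).flip (fun m a n => by
    simp only [LinearMap.flip_apply, LinearMap.compl₁₂_apply, LinearMap.mul_apply', hφ,
      LinearMap.comp_apply, AlgHom.toLinearMap_apply, D.ev_right, map_mul, mul_assoc]
    rw [hσ]) h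
  simp only [LinearMap.flip_apply, LinearMap.compl₁₂_apply, LinearMap.mul_apply',
    LinearMap.comp_apply, AlgHom.toLinearMap_apply] at this
  rw [this]
  simp only [← hφ]
  rw [← map_sum, D.zigzag_left]

end Duality

variable {K A Ω X : Type u} [Field K] [Ring A] [Algebra K A]
  [AddCommGroup Ω] [Module K Ω] [Module A Ω] [Module Aᵐᵒᵖ Ω]
  [AddCommGroup X] [Module K X] [Module A X] [Module Aᵐᵒᵖ X]
  {C : Calculus K A Ω} {P : Pivotal K A Ω X} {B : Type u} [Ring B] [Algebra K B]
  {σ : A →ₐ[K] B} {u : X →ₗ[K] B} {F : X →ₗ[K] Ω →ₗ[K] B} {G : Ω →ₗ[K] X →ₗ[K] B}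

/-! ### From the isotopy quotient to the presentation -/

namespace IsIsotopyModel

/-- The image of `ȳ = ∑ i, (ω i, y) x' i`. -/
def bar (P : Pivotal K A Ω X) (u : X →ₗ[K] B) (G : Ω →ₗ[K] X →ₗ[K] B) : X →ₗ[K] B :=
  ∑ i, LinearMap.mulRight K (u (P.evl.left i)) ∘ₗ G (P.evl.right i)

theorem bar_apply (v : X) :
    bar P u G v = ∑ i, G (P.evl.right i) v * u (P.evl.left i) := by
  simp [bar]

variable (h : IsIsotopyModel C P σ u F G)
include h

/-- A scalar can pass between `(ω, v)` and `x`, so the sum defining `v̄` may be computed with any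
representative of `coev(1)`, in particular with `∑ db_i ⊗ x_i`. -/
theorem sum_formVec_mul_vec {p q : ℕ} {f : Fin p → Ω} {g : Fin p → X} {f' : Fin q → Ω}
    {g' : Fin q → X} (hf : ∑ i, btmul K A (f i) (g i) = ∑ j, btmul K A (f' j) (g' j)) (v : X) :
    ∑ i, G (f i) v * u (g i) = ∑ j, G (f' j) v * u (g' j) :=
  sum_mul_eq_of_btmul_sum_eq (G.flip v) u (fun m a n => by
    simp [h.formVec_op_smul_left, ← h.left_mul, mul_assoc]) hf

theorem bar_eq_sum {p : ℕ} {f : Fin p → Ω} {g : Fin p → X}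
    (hf : ∑ i, btmul K A (f i) (g i) = P.evl.coevOne) (v : X) :
    bar P u G v = ∑ i, G (f i) v * u (g i) := by
  rw [bar_apply]
  exact (h.sum_formVec_mul_vec hf v).symm

theorem mul_bar (a : A) (v : X) : σ a * bar P u G v = bar P u G (v <• a) := by
  simp only [bar_apply, h.formVec_op_smul_right, Finset.mul_sum, mul_assoc]

/-- Move `a` leftwards past each `x'_i`. The terms `x'_i a` reassemble to `a • v̄` by centrality of
the coevaluation, and the terms `ev(x'_i ⊗ da)` contract with `ω_i` to `da`. -/
theorem bar_mul_eq_add_formVec (a : A) (v : X) :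
    bar P u G v * σ a = σ a * bar P u G v + G (C.d a) v := by
  have h1 := h.sum_formVec_mul_vec (P.evl.coev_central a) v
  have h2 := P.evl.sum_mul_ev_of_coevOne (σ := σ) (φ := G.flip v) rfl
    (fun w a => h.formVec_op_smul_left a w v) (C.d a)
  simp only [LinearMap.flip_apply] at h2
  simp only [bar_apply, Finset.sum_mul, Finset.mul_sum, ← mul_assoc, ← h.formVec_smul_left]
  rw [h1, ← h2, ← Finset.sum_add_distrib]
  simp only [mul_assoc, h.right_mul, mul_add]

/-- The same product, now commuting `a` past `x'_i` at the cost of `(x'_i, da)`; the extra terms sum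
up by `inv_left`. Comparing the two expansions determines `(da, v)`. -/
theorem bar_mul_eq_add_ev (a : A) (v : X) :
    bar P u G v * σ a = bar P u G (a • v) + σ (P.evr.ev (C.d a) v) := by
  rw [← h.inv_left]
  simp only [bar_apply, Finset.sum_mul, h.formVec_smul_right, mul_assoc, h.bar_mul, mul_add,
    Finset.sum_add_distrib]

theorem formVec_d (a : A) (v : X) :
    G (C.d a) v = bar P u G (a • v) + σ (P.evr.ev (C.d a) v) - bar P u G (v <• a) := by
  rw [← h.bar_mul_eq_add_ev, h.bar_mul_eq_add_formVec, ← h.mul_bar]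
  abel

theorem vecForm_d (a : A) (v : X) :
    F v (C.d a) = u (v <• a) + σ (P.evl.ev v (C.d a)) - u (a • v) := by
  rw [← h.right_mul, h.bar_mul, ← h.left_mul]
  abel

variable [IsScalarTower K Aᵐᵒᵖ Ω] [SMulCommClass A Aᵐᵒᵖ X]

/-- The right side depends on `r ⊗ s` only through `(dr)s` and `rs`, and both vanish on `𝒩`. This is
the source of the relation `bim`; `bar_bimod` plays the same role for `bar_bim`. -/
theorem vec_bimod (r s : A) (v : X) :
    u (s • v <• r) = F v (C.d r <• s) + u ((r * s) • v) - σ (P.evl.ev v (C.d r <• s)) := by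
  rw [h.vecForm_op_smul_right, ← h.vecForm_smul_left, h.vecForm_d, P.evl.ev_right, map_mul, h.comm,
    P.evl.ev_left, map_mul, smul_comm, mul_smul]
  abel

theorem bar_bimod (r s : A) (v : X) :
    bar P u G (s • v <• r) =
      bar P u G ((r * s) • v) + σ (P.evr.ev (C.d r <• s) v) - G (C.d r <• s) v := by
  rw [h.formVec_op_smul_left, ← h.formVec_smul_right, h.formVec_d, P.evr.ev_balanced, mul_smul,
    smul_comm]
  abel

theorem isPresentationModel {p q : ℕ} {b : Fin p → A} {x : Fin p → X} {y : Fin q → X}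
    {c : Fin q → A} (hbx : ∑ i, btmul K A (C.d (b i)) (x i) = P.evl.coevOne)
    (hyc : ∑ j, btmul K A (y j) (C.d (c j)) = P.evr.coevOne) :
    IsPresentationModel C P b x y c σ u (bar P u G) where
  comm := h.comm
  left_mul := h.left_mul
  right_mul := h.right_mul
  bar_left_mul := h.mul_bar
  bar_right_mul := h.bar_mul_eq_add_ev
  bim n r s hrs v := by
    have h1 : ∑ m, r m * s m = 0 := by simpa using hrs.1
    have h2 : ∑ m, C.d (r m) <• s m = 0 := by simpa using hrs.2
    simp only [h.vec_bimod, Finset.sum_sub_distrib, Finset.sum_add_distrib, ← map_sum,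
      ← Finset.sum_smul, h1, h2, map_zero, zero_smul, add_zero, sub_zero]
  bar_bim n r s hrs v := by
    have h1 : ∑ m, r m * s m = 0 := by simpa using hrs.1
    have h2 : ∑ m, C.d (r m) <• s m = 0 := by simpa using hrs.2
    simp only [h.bar_bimod, Finset.sum_sub_distrib, Finset.sum_add_distrib, ← map_sum,
      ← LinearMap.sum_apply, ← Finset.sum_smul, h1, h2, map_zero, zero_smul, add_zero, sub_zero,
      LinearMap.zero_apply]
  inv_left v := by
    conv_rhs => rw [h.bar_eq_sum hbx]
    -- Each summand is `[v̄, b_i] • x_i = (db_i, v) • x_i`.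
    refine Finset.sum_congr rfl fun i _ => ?_
    rw [← h.left_mul, ← h.mul_bar, ← mul_assoc, h.bar_mul_eq_add_formVec, add_mul]
    abel
  inv_right v := by
    have h1 : ∑ j, F v (C.d (c j)) * bar P u G (y j)
        = ∑ j, F v (P.evr.left j) * bar P u G (P.evr.right j) :=
      sum_eq_of_btmul_sum_eq ((LinearMap.mul K B).compl₁₂ (F v) (bar P u G)).flip
        (fun m a n => by
          simp [h.vecForm_smul_right, ← h.mul_bar, mul_assoc]) hyc
    -- After expanding the bar, `inv_right` collapses the sum over `j` to `ev(v ⊗ ω_i)`, and a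
    -- zigzag identity finishes.
    have h2 : ∑ j, F v (P.evr.left j) * bar P u G (P.evr.right j) = u v := by
      simp only [bar_apply, Finset.mul_sum]
      rw [Finset.sum_comm]
      simp only [← mul_assoc, ← Finset.sum_mul, h.inv_right, h.left_mul]
      rw [← map_sum, P.evl.zigzag_left]
    conv_rhs => rw [← h2, ← h1]
    refine Finset.sum_congr rfl fun j _ => ?_
    rw [← h.mul_bar, ← h.left_mul, ← mul_assoc, h.bar_mul, add_mul]
    abel
  hopf_left a v := by
    have h1 : ∑ j, F (y j) (C.d a) * G (C.d (c j)) v = σ (P.evl.ev v (C.d a)) := by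
      rw [← h.hopf_left]
      exact sum_mul_eq_of_btmul_sum_eq (F.flip (C.d a)) (G.flip v) (fun m a n => by
        simp [h.vecForm_op_smul_left, h.formVec_smul_left, mul_assoc]) hyc
    have h2 := P.evr.sum_mul_ev_of_coevOne (σ := σ) (φ := F.flip (C.d a)) hyc
      (fun w r => h.vecForm_op_smul_left r w _) v
    simp only [LinearMap.flip_apply] at h2
    -- Both bar differences carry the common factor `(dc_j, v) - ev'(dc_j ⊗ v)`, where `ev'` is
    -- `P.evr.ev`; what multiplies it is `[y_j, a] = (y_j, da)`. The two resulting sums are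
    -- evaluated by `hopf_left` and by a zigzag identity.
    have h3 : ∀ j, u (y j) * (bar P u G (c j • v <• a) - bar P u G (v <• (c j * a)))
        - u (a • y j) * (bar P u G (c j • v) - bar P u G (v <• c j))
        = F (y j) (C.d a) * G (C.d (c j)) v - F (y j) (C.d a) * σ (P.evr.ev (C.d (c j)) v) := by
      intro j
      rw [← mul_sub, h.formVec_d, MulOpposite.op_mul, mul_smul,
        smul_comm (c j) (MulOpposite.op a) v, ← h.mul_bar, ← h.mul_bar a,
        ← mul_sub, ← h.left_mul, ← mul_assoc, h.bar_mul, ← sub_mul, add_sub_cancel_left]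
      congr 1
      abel
    simp only [h3]
    rw [Finset.sum_sub_distrib, h1, h2, h.vecForm_d]
    abel
  hopf_right a v := by
    have h1 : ∑ i, G (C.d a) (x i) * F v (C.d (b i)) = σ (P.evr.ev (C.d a) v) := by
      rw [← h.hopf_right]
      exact sum_eq_of_btmul_sum_eq ((LinearMap.mul K B).compl₁₂ (G (C.d a)) (F v)).flip
        (fun m a n => by
          simp [h.vecForm_op_smul_right, h.formVec_smul_right, mul_assoc]) hbx
    have h2 := P.evl.sum_mul_ev_of_coevOne' (σ := σ) h.comm (φ := G (C.d a)) hbx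
      (fun w r => h.formVec_smul_right r _ w) v
    have h3 : ∀ i, bar P u G (x i <• a) * (u (v <• b i) - u (b i • v))
        - bar P u G (x i) * (u (a • v <• b i) - u ((a * b i) • v))
        = G (C.d a) (x i) * σ (P.evl.ev v (C.d (b i))) - G (C.d a) (x i) * F v (C.d (b i)) := by
      intro i
      rw [← mul_sub, h.vecForm_d, mul_smul, ← h.left_mul a, ← h.left_mul a, ← mul_sub, ← h.mul_bar,
        ← mul_assoc, h.bar_mul_eq_add_formVec, ← sub_mul, ← sub_sub_sub_cancel_left, sub_self]
      noncomm_ring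
    simp only [h3]
    rw [Finset.sum_sub_distrib, h1, h2, h.formVec_d]
    abel

end IsIsotopyModel

end

section

variable {K A Ω X : Type u} [Field K] [Ring A] [Algebra K A]
  [AddCommGroup Ω] [Module K Ω] [Module A Ω] [Module Aᵐᵒᵖ Ω]
  [AddCommGroup X] [Module K X] [Module A X] [Module Aᵐᵒᵖ X]
  {C : Calculus K A Ω} {P : Pivotal K A Ω X} {B : Type u} [Ring B] [Algebra K B]
  {σ : A →ₐ[K] B} {u w : X →ₗ[K] B}

/-! ### From the presentation back to the isotopy quotient -/

namespace IsPresentationModel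

variable [IsScalarTower K Aᵐᵒᵖ Ω] [SMulCommClass A Aᵐᵒᵖ X]
  {p q : ℕ} {b : Fin p → A} {x : Fin p → X} {y : Fin q → X} {c : Fin q → A}
  (h : IsPresentationModel C P b x y c σ u w)
include h

/-- The prescribed value `s[v, r]` expands, as in `hT'`, into terms in `(dr)s` and `rs` plus the
term `u (s • v <• r)`, which the relation `bim` kills on `𝒩`. -/
theorem exists_vecForm (hC : C.Surjective) : ∃ F : X →ₗ[K] Ω →ₗ[K] B,
    ∀ v r s, F v (C.d r <• s) = σ s * (u v * σ r - σ r * u v) := by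
  let T : A ⊗[K] A →ₗ[K] (X →ₗ[K] B) := TensorProduct.lift <|
    LinearMap.mk₂ K (fun r s => LinearMap.mulLeft K (σ s) ∘ₗ
        (LinearMap.mulRight K (σ r) - LinearMap.mulLeft K (σ r)) ∘ₗ u)
      (fun r r' s => by ext; simp; noncomm_ring)
      (fun k r s => by ext; simp [mul_sub, smul_sub])
      (fun r s s' => by ext; simp [add_mul])
      (fun k r s => by ext; simp)
  have hT : ∀ r s v, T (r ⊗ₜ s) v = σ s * (u v * σ r - σ r * u v) := fun r s v => rfl
  have hT' : ∀ r s v, T (r ⊗ₜ s) v =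
      u (s • v <• r) + σ (P.evl.ev v (C.d r <• s)) - u ((r * s) • v) := fun r s v => by
    rw [hT, mul_sub, h.right_mul, mul_add, h.left_mul, ← mul_assoc, h.comm s r, ← map_mul σ r,
      h.left_mul, P.evl.ev_right, map_mul, h.comm s]
  obtain ⟨F, hF⟩ := hC.exists_factor T (fun s => by ext v; simp [hT]) (fun n r s hrs => by
    have h1 : ∑ m, r m * s m = 0 := by simpa using hrs.1
    have h2 : ∑ m, C.d (r m) <• s m = 0 := by simpa using hrs.2
    ext v
    simp only [LinearMap.sum_apply, hT', Finset.sum_sub_distrib, Finset.sum_add_distrib,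
      h.bim n r s hrs]
    simp only [← map_sum, ← Finset.sum_smul, h1, h2, map_zero, zero_smul, add_zero, sub_zero,
      LinearMap.zero_apply])
  exact ⟨F.flip, fun v r s => by rw [LinearMap.flip_apply, hF, hT]⟩

theorem exists_formVec (hC : C.Surjective) : ∃ G : Ω →ₗ[K] X →ₗ[K] B,
    ∀ r s v, G (C.d r <• s) v = (w v * σ r - σ r * w v) * σ s := by
  let T : A ⊗[K] A →ₗ[K] (X →ₗ[K] B) := TensorProduct.lift <|
    LinearMap.mk₂ K (fun r s => LinearMap.mulRight K (σ s) ∘ₗ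
        (LinearMap.mulRight K (σ r) - LinearMap.mulLeft K (σ r)) ∘ₗ w)
      (fun r r' s => by ext; simp; noncomm_ring)
      (fun k r s => by ext; simp [sub_mul, smul_sub])
      (fun r s s' => by ext; simp [mul_add])
      (fun k r s => by ext; simp)
  have hT : ∀ r s v, T (r ⊗ₜ s) v = (w v * σ r - σ r * w v) * σ s := fun r s v => rfl
  have hT' : ∀ r s v, T (r ⊗ₜ s) v =
      w ((r * s) • v) + σ (P.evr.ev (C.d r <• s) v) - w (s • v <• r) := fun r s v => by
    -- Replacing `v̄ • s` by the bar of `sv` costs only an element of `A`, which commutes with `r`.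
    have h1 : (w v * σ r - σ r * w v) * σ s = w (s • v) * σ r - σ r * w (s • v) := by
      rw [eq_sub_of_add_eq (h.bar_right_mul s v).symm, sub_mul (w v * σ s), mul_sub (σ r),
        h.comm r (P.evr.ev _ _), sub_sub_sub_cancel_right, sub_mul, mul_assoc, mul_assoc,
        mul_assoc, h.comm r s]
    rw [hT, h1, h.bar_right_mul, h.bar_left_mul, P.evr.ev_balanced, mul_smul,
      smul_comm s (MulOpposite.op r)]
  obtain ⟨G, hG⟩ := hC.exists_factor T (fun s => by ext v; simp [hT]) (fun n r s hrs => by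
    have h1 : ∑ m, r m * s m = 0 := by simpa using hrs.1
    have h2 : ∑ m, C.d (r m) <• s m = 0 := by simpa using hrs.2
    ext v
    simp only [LinearMap.sum_apply, hT', Finset.sum_sub_distrib, Finset.sum_add_distrib,
      h.bar_bim n r s hrs]
    simp only [← map_sum, ← LinearMap.sum_apply, ← Finset.sum_smul, h1, h2, map_zero, zero_smul,
      add_zero, sub_zero, LinearMap.zero_apply])
  exact ⟨G, fun r s v => by rw [hG, hT]⟩

theorem sum_formVec_mul_vec {G : Ω →ₗ[K] X →ₗ[K] B}
    (hG : ∀ r s v, G (C.d r <• s) v = (w v * σ r - σ r * w v) * σ s) (v : X) :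
    ∑ i, G (C.d (b i)) v * u (x i) = w v := by
  rw [← h.inv_left v]
  refine Finset.sum_congr rfl fun i _ => ?_
  have hGd : G (C.d (b i)) v = w v * σ (b i) - σ (b i) * w v := by simpa using hG (b i) 1 v
  rw [hGd, ← h.left_mul, ← h.bar_left_mul, sub_mul, mul_assoc]

theorem isIsotopyModel [IsScalarTower K A Ω] [IsScalarTower K A X] [IsScalarTower K Aᵐᵒᵖ X]
    [SMulCommClass A Aᵐᵒᵖ Ω] (hC : C.Surjective)
    (hbx : ∑ i, btmul K A (C.d (b i)) (x i) = P.evl.coevOne)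
    (hyc : ∑ j, btmul K A (y j) (C.d (c j)) = P.evr.coevOne)
    {F : X →ₗ[K] Ω →ₗ[K] B} {G : Ω →ₗ[K] X →ₗ[K] B}
    (hF : ∀ v r s, F v (C.d r <• s) = σ s * (u v * σ r - σ r * u v))
    (hG : ∀ r s v, G (C.d r <• s) v = (w v * σ r - σ r * w v) * σ s) :
    IsIsotopyModel C P σ u F G := by
  have hFd : ∀ v r, F v (C.d r) = u v * σ r - σ r * u v := fun v r => by
    simpa using hF v r 1
  have hGd : ∀ r v, G (C.d r) v = w v * σ r - σ r * w v := fun r v => by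
    simpa using hG r 1 v
  have F1 : ∀ a v ω, F (a • v) ω = σ a * F v ω := fun a v => hC.ext_d_smul
    (by simp) (by simp [mul_add]) (fun r s => by
      rw [hF, hF, ← h.left_mul, ← mul_assoc (σ a), h.comm a s, mul_assoc (σ s), mul_sub (σ a),
        ← mul_assoc (σ r), h.comm r a,
        mul_assoc, mul_assoc])
  have F2 : ∀ a v ω, F (v <• a) ω = F v ω * σ a := fun a v => hC.ext_d_smul
    (by simp) (by simp [add_mul]) (fun r s => by
      rw [hF, hF, eq_sub_of_add_eq (h.right_mul a v).symm, mul_assoc, sub_mul, sub_mul,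
        mul_sub (σ r), h.comm r (P.evl.ev v _),
        sub_sub_sub_cancel_right, mul_assoc, mul_assoc, mul_assoc, h.comm a r])
  have F4 : ∀ a v ω, F v (ω <• a) = σ a * F v ω := fun a v => hC.ext_d_smul
    (by simp) (by simp [mul_add]) (fun r s => by
      rw [← mul_smul, ← MulOpposite.op_mul, hF, hF, map_mul, h.comm s a, mul_assoc])
  -- Here `a dr = d(ar) - (da)r`, and `[v, ar] - r[v, a] = [v, r]a` because the commutator is a
  -- derivation and the image of `A` is commutative.
  have F3 : ∀ a v ω, F v (a • ω) = F v ω * σ a := fun a v => hC.ext_d_smul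
    (by simp) (by simp [add_mul]) (fun r s => by
      rw [smul_comm, F4, C.smul_d, map_sub, hFd, hF, hF, map_mul, h.comm a r, mul_assoc (σ s)]
      noncomm_ring)
  have G2 : ∀ a ω v, G (ω <• a) v = G ω v * σ a := fun a ω v => hC.ext_d_smul
    (f := fun ω => G (ω <• a) v)
    (g := fun ω => G ω v * σ a)
    (by simp) (by simp [add_mul]) (fun r s => by
      rw [← mul_smul, ← MulOpposite.op_mul, hG, hG, map_mul, mul_assoc]) ω
  have G1 : ∀ a ω v, G (a • ω) v = σ a * G ω v := fun a ω v => hC.ext_d_smul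
    (f := fun ω => G (a • ω) v)
    (g := fun ω => σ a * G ω v)
    (by simp) (by simp [mul_add]) (fun r s => by
      rw [smul_comm, G2, C.smul_d, map_sub, LinearMap.sub_apply, hGd, hG, hG, map_mul]
      noncomm_ring) ω
  have G3 : ∀ a ω v, G ω (a • v) = G ω v * σ a := fun a ω v => hC.ext_d_smul
    (f := fun ω => G ω (a • v))
    (g := fun ω => G ω v * σ a)
    (by simp) (by simp [add_mul]) (fun r s => by
      rw [hG, hG, eq_sub_of_add_eq (h.bar_right_mul a v).symm, mul_assoc, h.comm s a, ← mul_assoc]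
      congr 1
      rw [sub_mul, sub_mul, mul_sub (σ r), h.comm r (P.evr.ev _ v),
        sub_sub_sub_cancel_right, mul_assoc, mul_assoc, mul_assoc, h.comm a r]) ω
  have G4 : ∀ a ω v, G ω (v <• a) = σ a * G ω v := fun a ω v => hC.ext_d_smul
    (f := fun ω => G ω (v <• a))
    (g := fun ω => σ a * G ω v)
    (by simp) (by simp [mul_add]) (fun r s => by
      rw [hG, hG, ← h.bar_left_mul, ← mul_assoc (σ a), mul_sub (σ a), ← mul_assoc (σ r), h.comm r a,
        mul_assoc (σ a), mul_assoc (σ a)]) ω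
  have hbar := h.sum_formVec_mul_vec hG
  have hvec : ∀ v, ∑ j, F v (C.d (c j)) * w (y j) = u v := fun v => by
    rw [← h.inv_right v]
    refine Finset.sum_congr rfl fun j _ => ?_
    rw [hFd, ← h.left_mul, ← h.bar_left_mul, sub_mul, mul_assoc]
  exact
  { comm := h.comm
    left_mul := h.left_mul
    right_mul := h.right_mul
    bar_mul := fun a v => by rw [hFd]; abel
    vecForm_smul_left := F1
    vecForm_op_smul_left := F2
    vecForm_smul_right := F3
    vecForm_op_smul_right := F4
    formVec_smul_left := G1
    formVec_op_smul_left := G2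
    formVec_smul_right := G3
    formVec_op_smul_right := G4
    -- In each of the four duality relations `ω` is tested on `s dr` or on `(dr)s`, whichever puts
    -- `s` at an outer end of the product, so that only the case of an exact form `dr` remains.
    inv_left := fun v ω => by
      have h1 := sum_mul_eq_of_btmul_sum_eq (G.flip v) (F.flip ω) (fun m a n => by
        simp [G2, F1, mul_assoc]) hbx
      simp only [LinearMap.flip_apply] at h1
      rw [← h1]
      refine hC.ext_smul_d (f := fun ω => ∑ i, G (C.d (b i)) v * F (x i) ω)
        (g := fun ω => σ (P.evr.ev ω v)) (by simp [mul_add, Finset.sum_add_distrib]) (by simp)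
        (fun r s => ?_) ω
      have h2 : ∀ i, G (C.d (b i)) v * F (x i) (s • C.d r)
          = (G (C.d (b i)) v * u (x i) * σ r - G (C.d (b i)) (r • v) * u (x i)) * σ s := fun i => by
        rw [F3, hFd, G3]
        noncomm_ring
      simp only [h2]
      rw [← Finset.sum_mul, Finset.sum_sub_distrib, ← Finset.sum_mul, hbar, hbar, h.bar_right_mul,
        add_sub_cancel_left, P.evr.ev_left, map_mul, h.comm]
    inv_right := fun v ω => by
      have h1 := sum_eq_of_btmul_sum_eq ((LinearMap.mul K B).compl₁₂ (F v) (G ω)).flip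
        (fun m a n => by simp [F3, G4, mul_assoc]) hyc
      simp only [LinearMap.flip_apply, LinearMap.compl₁₂_apply, LinearMap.mul_apply'] at h1
      rw [← h1]
      refine hC.ext_d_smul (f := fun ω => ∑ j, F v (C.d (c j)) * G ω (y j))
        (g := fun ω => σ (P.evl.ev v ω)) (by simp [mul_add, Finset.sum_add_distrib]) (by simp)
        (fun r s => ?_) ω
      have h2 : ∀ j, F v (C.d (c j)) * G (C.d r <• s) (y j)
          = (F v (C.d (c j)) * w (y j) * σ r - F (v <• r) (C.d (c j)) * w (y j)) * σ s :=
        fun j => by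
        rw [G2, hGd, F2]
        noncomm_ring
      simp only [h2]
      rw [← Finset.sum_mul, Finset.sum_sub_distrib, ← Finset.sum_mul, hvec, hvec, h.right_mul,
        add_sub_cancel_left, P.evl.ev_right, map_mul]
    hopf_left := fun v ω => by
      have h1 := sum_mul_eq_of_btmul_sum_eq (F.flip ω) (G.flip v) (fun m a n => by
        simp [F2, G1, mul_assoc]) hyc
      simp only [LinearMap.flip_apply] at h1
      rw [← h1]
      refine hC.ext_d_smul (f := fun ω => ∑ j, F (y j) ω * G (C.d (c j)) v)
        (g := fun ω => σ (P.evl.ev v ω)) (by simp [add_mul, Finset.sum_add_distrib]) (by simp)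
        (fun r s => ?_) ω
      have h2 := P.evr.sum_mul_ev_of_coevOne (σ := σ) (φ := F.flip (C.d r)) hyc
        (fun z a => F2 a z _) v
      simp only [LinearMap.flip_apply] at h2
      have h3 : ∀ j, F (y j) (C.d r <• s) * G (C.d (c j)) v
          = σ s * ((u (y j) * (w (c j • v <• r) - w (v <• (c j * r)))
            - u (r • y j) * (w (c j • v) - w (v <• c j)))
            + F (y j) (C.d r) * σ (P.evr.ev (C.d (c j)) v)) := fun j => by
        rw [F4, mul_assoc, hGd, h.bar_right_mul, h.bar_left_mul, MulOpposite.op_mul, mul_smul,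
          smul_comm (c j) (MulOpposite.op r) v, ← h.bar_left_mul r, ← h.bar_left_mul r,
          ← h.left_mul, hFd]
        noncomm_ring
      simp only [h3]
      rw [← Finset.mul_sum, Finset.sum_add_distrib, h.hopf_left, h2, hFd, h.right_mul, h.left_mul,
        P.evl.ev_right, map_mul, h.comm _ s]
      congr 1
      abel
    hopf_right := fun v ω => by
      have h1 := sum_eq_of_btmul_sum_eq ((LinearMap.mul K B).compl₁₂ (G ω) (F v)).flip
        (fun m a n => by simp [F4, G3, mul_assoc]) hbx
      simp only [LinearMap.flip_apply, LinearMap.compl₁₂_apply, LinearMap.mul_apply'] at h1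
      rw [← h1]
      refine hC.ext_smul_d (f := fun ω => ∑ i, G ω (x i) * F v (C.d (b i)))
        (g := fun ω => σ (P.evr.ev ω v)) (by simp [add_mul, Finset.sum_add_distrib]) (by simp)
        (fun r s => ?_) ω
      have h2 := P.evl.sum_mul_ev_of_coevOne' (σ := σ) h.comm (φ := G (C.d r)) hbx
        (fun z a => G3 a _ z) v
      have h3 : ∀ i, G (s • C.d r) (x i) * F v (C.d (b i))
          = σ s * (G (C.d r) (x i) * σ (P.evl.ev v (C.d (b i)))
            - (w (x i <• r) * (u (v <• b i) - u (b i • v))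
              - w (x i) * (u (r • v <• b i) - u ((r * b i) • v)))) := fun i => by
        rw [G1, mul_assoc, hFd, h.right_mul, h.left_mul, mul_smul, ← h.left_mul r, ← h.left_mul r,
          ← h.bar_left_mul, hGd]
        noncomm_ring
      simp only [h3]
      rw [← Finset.mul_sum, Finset.sum_sub_distrib, h.hopf_right, h2, hGd, h.bar_right_mul,
        h.bar_left_mul, P.evr.ev_left, map_mul]
      congr 1
      abel }

end IsPresentationModel

end

section

variable {K A Ω X : Type u} [Field K] [Ring A] [Algebra K A]
  [AddCommGroup Ω] [Module K Ω] [Module A Ω] [Module Aᵐᵒᵖ Ω]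
  [AddCommGroup X] [Module K X] [Module A X] [Module Aᵐᵒᵖ X]
  {B : Type u} [Ring B] [Algebra K B]

/-! ### Universal property of the presented algebra -/

theorem freeProduct_lift_ι {I : Type} [DecidableEq I] {R : I → Type u} [∀ i, Ring (R i)]
    [∀ i, Algebra K (R i)] (maps : ∀ i, R i →ₐ[K] B) (i : I) (r : R i) :
    LinearAlgebra.FreeProduct.lift K R (fun {i} => maps i)
      (LinearAlgebra.FreeProduct.ι K R i r) = maps i r :=
  DFunLike.congr_fun (LinearAlgebra.FreeProduct.lift_comp_ι K R (fun {i} => maps i) (i := i)) r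

theorem freeProduct_hom_ext {I : Type} [DecidableEq I] {R : I → Type u} [∀ i, Ring (R i)]
    [∀ i, Algebra K (R i)] {f g : LinearAlgebra.FreeProduct K R →ₐ[K] B}
    (h : ∀ i, f.comp (LinearAlgebra.FreeProduct.ι K R i) =
      g.comp (LinearAlgebra.FreeProduct.ι K R i)) : f = g :=
  (LinearAlgebra.FreeProduct.lift K R).symm.injective (by
    funext i
    exact h i)

section Presentation

/-- The restriction to the generators `x` of an algebra map out of `A_ab ⋆ T X ⋆ T X`. -/
noncomputable def QFree.vecRestrict (f : QFree K A X →ₐ[K] B) : X →ₗ[K] B :=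
  (f.comp (LinearAlgebra.FreeProduct.ι K (QFactor K A X) .vec) :
    TensorAlgebra K X →ₐ[K] B).toLinearMap ∘ₗ TensorAlgebra.ι K

/-- The restriction to the generators `x̄` of an algebra map out of `A_ab ⋆ T X ⋆ T X`. -/
noncomputable def QFree.barRestrict (f : QFree K A X →ₐ[K] B) : X →ₗ[K] B :=
  (f.comp (LinearAlgebra.FreeProduct.ι K (QFactor K A X) .bar) :
    TensorAlgebra K X →ₐ[K] B).toLinearMap ∘ₗ TensorAlgebra.ι K

theorem QFree.vecRestrict_apply (f : QFree K A X →ₐ[K] B) (v : X) :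
    QFree.vecRestrict f v = f (QFree.vec K A v) := rfl

theorem QFree.barRestrict_apply (f : QFree K A X →ₐ[K] B) (v : X) :
    QFree.barRestrict f v = f (QFree.bar K A v) := rfl

variable (X) in
/-- The maps on the three factors that extend `σ`, `u` and `w`. -/
noncomputable def QFactor.hom (σ : A →ₐ[K] B) (hσ : ∀ a b, σ a * σ b = σ b * σ a)
    (u w : X →ₗ[K] B) : ∀ i, QFactor K A X i →ₐ[K] B
  | .base => RingQuot.liftAlgHom K ⟨σ, by rintro _ _ ⟨a, b⟩; simp [hσ a b]⟩
  | .vec => TensorAlgebra.lift K u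
  | .bar => TensorAlgebra.lift K w

variable (σ : A →ₐ[K] B) (hσ : ∀ a b, σ a * σ b = σ b * σ a) (u w : X →ₗ[K] B)

/-- The map out of the free product `A_ab ⋆ T X ⋆ T X` that extends `σ`, `u` and `w`. -/
noncomputable def QFree.lift : QFree K A X →ₐ[K] B :=
  LinearAlgebra.FreeProduct.lift K (QFactor K A X) (fun {i} => QFactor.hom X σ hσ u w i)

@[simp]
theorem QFree.lift_scal (a : A) : QFree.lift σ hσ u w (QFree.scal K A X a) = σ a := by
  refine (freeProduct_lift_ι (QFactor.hom X σ hσ u w) .base (Ab.mk K A a)).trans ?_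
  exact RingQuot.liftAlgHom_mkAlgHom_apply K _ _ _

@[simp]
theorem QFree.lift_vec (v : X) : QFree.lift σ hσ u w (QFree.vec K A v) = u v :=
  (freeProduct_lift_ι (QFactor.hom X σ hσ u w) .vec (TensorAlgebra.ι K v)).trans
    (TensorAlgebra.lift_ι_apply _ _)

@[simp]
theorem QFree.lift_bar (v : X) : QFree.lift σ hσ u w (QFree.bar K A v) = w v :=
  (freeProduct_lift_ι (QFactor.hom X σ hσ u w) .bar (TensorAlgebra.ι K v)).trans
    (TensorAlgebra.lift_ι_apply _ _)

theorem QFree.hom_ext {f g : QFree K A X →ₐ[K] B}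
    (h₁ : ∀ a, f (QFree.scal K A X a) = g (QFree.scal K A X a))
    (h₂ : ∀ v, f (QFree.vec K A v) = g (QFree.vec K A v))
    (h₃ : ∀ v, f (QFree.bar K A v) = g (QFree.bar K A v)) : f = g := by
  refine freeProduct_hom_ext fun i => ?_
  cases i with
  | base =>
    exact RingQuot.ringQuot_ext' K (f.comp (QFree.base K A X)) (g.comp (QFree.base K A X))
      (AlgHom.ext h₁)
  | vec => exact TensorAlgebra.hom_ext (LinearMap.ext h₂)
  | bar => exact TensorAlgebra.hom_ext (LinearMap.ext h₃)

variable [IsScalarTower K Aᵐᵒᵖ Ω] (C : Calculus K A Ω) (P : Pivotal K A Ω X)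
  {p q : ℕ} (b : Fin p → A) (x : Fin p → X) (y : Fin q → X) (c : Fin q → A)

theorem QAlg.mk_eq {s t : QFree K A X} (h : QRel C P b x y c s t) :
    QAlg.mk C P b x y c s = QAlg.mk C P b x y c t :=
  RingQuot.mkAlgHom_rel K h

/-- The generators of the presented algebra satisfy its relations. -/
theorem QAlg.isPresentationModel :
    IsPresentationModel C P b x y c
      ((QAlg.mk C P b x y c).comp ((QFree.base K A X).comp (Ab.mk K A)))
      (QFree.vecRestrict (B := QAlg C P b x y c) (QAlg.mk C P b x y c))
      (QFree.barRestrict (B := QAlg C P b x y c) (QAlg.mk C P b x y c)) where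
  comm a a' := by
    rw [← map_mul, ← map_mul]
    exact congrArg (fun t => QAlg.mk C P b x y c (QFree.base K A X t))
      (RingQuot.mkAlgHom_rel K (AbRel.swap a a'))
  left_mul a v := by
    simpa [QFree.vecRestrict_apply, QFree.barRestrict_apply, QFree.scal,
      -Finset.sum_sub_distrib] using
      QAlg.mk_eq C P b x y c (.left_mul a v)
  right_mul a v := by
    simpa [QFree.vecRestrict_apply, QFree.barRestrict_apply, QFree.scal,
      -Finset.sum_sub_distrib] using
      QAlg.mk_eq C P b x y c (.right_mul a v)
  bar_left_mul a v := by
    simpa [QFree.vecRestrict_apply, QFree.barRestrict_apply, QFree.scal,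
      -Finset.sum_sub_distrib] using
      QAlg.mk_eq C P b x y c (.bar_left_mul a v)
  bar_right_mul a v := by
    simpa [QFree.vecRestrict_apply, QFree.barRestrict_apply, QFree.scal,
      -Finset.sum_sub_distrib] using
      QAlg.mk_eq C P b x y c (.bar_right_mul a v)
  bim n r s h v := by
    simpa [QFree.vecRestrict_apply, QFree.barRestrict_apply, QFree.scal,
      -Finset.sum_sub_distrib] using
      QAlg.mk_eq C P b x y c (.bim n r s h v)
  bar_bim n r s h v := by
    simpa [QFree.vecRestrict_apply, QFree.barRestrict_apply, QFree.scal,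
      -Finset.sum_sub_distrib] using
      QAlg.mk_eq C P b x y c (.bar_bim n r s h v)
  inv_left v := by
    simpa [QFree.vecRestrict_apply, QFree.barRestrict_apply, QFree.scal,
      -Finset.sum_sub_distrib] using
      QAlg.mk_eq C P b x y c (.inv_left v)
  inv_right v := by
    simpa [QFree.vecRestrict_apply, QFree.barRestrict_apply, QFree.scal,
      -Finset.sum_sub_distrib] using
      QAlg.mk_eq C P b x y c (.inv_right v)
  hopf_left a v := by
    simpa [QFree.vecRestrict_apply, QFree.barRestrict_apply, QFree.scal,
      -Finset.sum_sub_distrib] using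
      QAlg.mk_eq C P b x y c (.hopf_left a v)
  hopf_right a v := by
    simpa [QFree.vecRestrict_apply, QFree.barRestrict_apply, QFree.scal,
      -Finset.sum_sub_distrib] using
      QAlg.mk_eq C P b x y c (.hopf_right a v)

variable {C P b x y c σ u w}

theorem IsPresentationModel.exists_lift (h : IsPresentationModel C P b x y c σ u w) :
    ∃ f : QAlg C P b x y c →ₐ[K] B,
      (∀ a, f (QAlg.mk C P b x y c (QFree.scal K A X a)) = σ a) ∧
      (∀ v, f (QAlg.mk C P b x y c (QFree.vec K A v)) = u v) ∧
      (∀ v, f (QAlg.mk C P b x y c (QFree.bar K A v)) = w v) := by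
  have hrel : ∀ ⦃s t⦄, QRel C P b x y c s t →
      QFree.lift σ h.comm u w s = QFree.lift σ h.comm u w t := by
    rintro _ _ (_ | _ | _ | _ | ⟨n, r, s, hrs, v⟩ | ⟨n, r, s, hrs, v⟩ | v | v | ⟨a, v⟩ | ⟨a, v⟩)
    · simpa using h.left_mul _ _
    · simpa using h.right_mul _ _
    · simpa using h.bar_left_mul _ _
    · simpa using h.bar_right_mul _ _
    · simpa using h.bim n r s hrs v
    · simpa using h.bar_bim n r s hrs v
    · simpa using h.inv_left v
    · simpa using h.inv_right v
    · simpa using h.hopf_left a v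
    · simpa using h.hopf_right a v
  refine ⟨RingQuot.liftAlgHom K ⟨QFree.lift σ h.comm u w, hrel⟩, fun a => ?_, fun v => ?_,
    fun v => ?_⟩ <;>
  simp [QAlg.mk]

theorem QAlg.hom_ext {f g : QAlg C P b x y c →ₐ[K] B}
    (h₁ : ∀ a, f (QAlg.mk C P b x y c (QFree.scal K A X a)) =
      g (QAlg.mk C P b x y c (QFree.scal K A X a)))
    (h₂ : ∀ v, f (QAlg.mk C P b x y c (QFree.vec K A v)) =
      g (QAlg.mk C P b x y c (QFree.vec K A v)))
    (h₃ : ∀ v, f (QAlg.mk C P b x y c (QFree.bar K A v)) =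
      g (QAlg.mk C P b x y c (QFree.bar K A v))) : f = g :=
  RingQuot.ringQuot_ext' K f g (QFree.hom_ext h₁ h₂ h₃)

end Presentation

end

section

variable {K A Ω X : Type u} [Field K] [Ring A] [Algebra K A]
  [AddCommGroup Ω] [Module K Ω] [Module A Ω] [Module Aᵐᵒᵖ Ω]
  [AddCommGroup X] [Module K X] [Module A X] [Module Aᵐᵒᵖ X]
  {B : Type u} [Ring B] [Algebra K B]

/-! ### Universal property of the isotopy quotient -/

section HAlgebra

/-- The restriction to the generators `x` of an algebra map out of the free product. -/
noncomputable def HFree.vecRestrict (f : HFree K A Ω X →ₐ[K] B) : X →ₗ[K] B :=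
  (f.comp (LinearAlgebra.FreeProduct.ι K (HFactor K A Ω X) .vec) :
    TensorAlgebra K X →ₐ[K] B).toLinearMap ∘ₗ TensorAlgebra.ι K

/-- The restriction to the generators `(x, ω)` of an algebra map out of the free product. -/
noncomputable def HFree.vecFormRestrict (f : HFree K A Ω X →ₐ[K] B) : X →ₗ[K] Ω →ₗ[K] B :=
  TensorProduct.curry ((f.comp (LinearAlgebra.FreeProduct.ι K (HFactor K A Ω X) .vecForm) :
    TensorAlgebra K (X ⊗[K] Ω) →ₐ[K] B).toLinearMap ∘ₗ TensorAlgebra.ι K)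

/-- The restriction to the generators `(ω, x)` of an algebra map out of the free product. -/
noncomputable def HFree.formVecRestrict (f : HFree K A Ω X →ₐ[K] B) : Ω →ₗ[K] X →ₗ[K] B :=
  TensorProduct.curry ((f.comp (LinearAlgebra.FreeProduct.ι K (HFactor K A Ω X) .formVec) :
    TensorAlgebra K (Ω ⊗[K] X) →ₐ[K] B).toLinearMap ∘ₗ TensorAlgebra.ι K)

theorem HFree.vecRestrict_apply (f : HFree K A Ω X →ₐ[K] B) (v : X) :
    HFree.vecRestrict f v = f (HFree.vec K A v) := rfl

theorem HFree.vecFormRestrict_apply (f : HFree K A Ω X →ₐ[K] B) (v : X) (w : Ω) :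
    HFree.vecFormRestrict f v w = f (HFree.vecForm K A v w) := rfl

theorem HFree.formVecRestrict_apply (f : HFree K A Ω X →ₐ[K] B) (w : Ω) (v : X) :
    HFree.formVecRestrict f w v = f (HFree.formVec K A w v) := rfl

variable (σ : A →ₐ[K] B) (hσ : ∀ a b, σ a * σ b = σ b * σ a) (u : X →ₗ[K] B)
  (F : X →ₗ[K] Ω →ₗ[K] B) (G : Ω →ₗ[K] X →ₗ[K] B)

/-- The maps on the four factors that extend `σ`, on both copies of `A`, and `u`, `F` and `G`. -/
noncomputable def HFactor.hom : ∀ i, HFactor K A Ω X i →ₐ[K] B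
  | .base => Algebra.TensorProduct.lift σ (AlgHom.fromOpposite σ hσ) (fun a b => hσ a b.unop)
  | .vec => TensorAlgebra.lift K u
  | .vecForm => TensorAlgebra.lift K (TensorProduct.lift F)
  | .formVec => TensorAlgebra.lift K (TensorProduct.lift G)

/-- The map out of the free product that extends `σ`, on both copies of `A`, and `u`, `F`, `G`. -/
noncomputable def HFree.lift : HFree K A Ω X →ₐ[K] B :=
  LinearAlgebra.FreeProduct.lift K (HFactor K A Ω X) (fun {i} => HFactor.hom σ hσ u F G i)

@[simp]
theorem HFree.lift_src (a : A) : HFree.lift σ hσ u F G (HFree.src K A Ω X a) = σ a :=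
  (freeProduct_lift_ι (HFactor.hom σ hσ u F G) .base (a ⊗ₜ 1)).trans
    ((Algebra.TensorProduct.lift_tmul σ (AlgHom.fromOpposite σ hσ)
      (fun a b => hσ a b.unop) _ _).trans
      (by rw [map_one, mul_one]))

@[simp]
theorem HFree.lift_tgt (a : Aᵐᵒᵖ) :
    HFree.lift σ hσ u F G (HFree.tgt K A Ω X a) = σ a.unop :=
  (freeProduct_lift_ι (HFactor.hom σ hσ u F G) .base (1 ⊗ₜ a)).trans
    ((Algebra.TensorProduct.lift_tmul σ (AlgHom.fromOpposite σ hσ)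
      (fun a b => hσ a b.unop) _ _).trans
      (by rw [map_one, one_mul]; rfl))

@[simp]
theorem HFree.lift_vec (v : X) : HFree.lift σ hσ u F G (HFree.vec K A v) = u v :=
  (freeProduct_lift_ι (HFactor.hom σ hσ u F G) .vec (TensorAlgebra.ι K v)).trans
    (TensorAlgebra.lift_ι_apply _ _)

@[simp]
theorem HFree.lift_vecForm (v : X) (w : Ω) :
    HFree.lift σ hσ u F G (HFree.vecForm K A v w) = F v w :=
  (freeProduct_lift_ι (HFactor.hom σ hσ u F G) .vecForm (TensorAlgebra.ι K (v ⊗ₜ w))).trans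
    ((TensorAlgebra.lift_ι_apply _ _).trans (TensorProduct.lift.tmul _ _))

@[simp]
theorem HFree.lift_formVec (w : Ω) (v : X) :
    HFree.lift σ hσ u F G (HFree.formVec K A w v) = G w v :=
  (freeProduct_lift_ι (HFactor.hom σ hσ u F G) .formVec (TensorAlgebra.ι K (w ⊗ₜ v))).trans
    ((TensorAlgebra.lift_ι_apply _ _).trans (TensorProduct.lift.tmul _ _))

theorem HFree.hom_ext {f g : HFree K A Ω X →ₐ[K] B}
    (h₁ : ∀ a, f (HFree.src K A Ω X a) = g (HFree.src K A Ω X a))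
    (h₂ : ∀ a, f (HFree.tgt K A Ω X a) = g (HFree.tgt K A Ω X a))
    (h₃ : ∀ v, f (HFree.vec K A v) = g (HFree.vec K A v))
    (h₄ : ∀ v w, f (HFree.vecForm K A v w) = g (HFree.vecForm K A v w))
    (h₅ : ∀ w v, f (HFree.formVec K A w v) = g (HFree.formVec K A w v)) : f = g := by
  refine freeProduct_hom_ext fun i => ?_
  cases i with
  | base => exact Algebra.TensorProduct.ext (AlgHom.ext h₁) (AlgHom.ext h₂)
  | vec => exact TensorAlgebra.hom_ext (LinearMap.ext h₃)
  | vecForm => exact TensorAlgebra.hom_ext (TensorProduct.ext' h₄)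
  | formVec => exact TensorAlgebra.hom_ext (TensorProduct.ext' h₅)

variable (C : Calculus K A Ω) (P : Pivotal K A Ω X)

/-- The isotopy quotient of `H𝔛`. -/
abbrev IsotopyAlg (C : Calculus K A Ω) (P : Pivotal K A Ω X) : Type u :=
  IsotopyQuotient (K := K) (A := A) (H := HAlg C P) (HAlg.source C P) (HAlg.target C P)

/-- The projection of the free product onto the isotopy quotient of `H𝔛`. -/
noncomputable def HFree.toIsotopyQuotient :
    HFree K A Ω X →ₐ[K] IsotopyAlg C P :=
  (IsotopyQuotient.mk (H := HAlg C P) (HAlg.source C P) (HAlg.target C P)).comp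
    (RingQuot.mkAlgHom K (HRel C P))

theorem HFree.toIsotopyQuotient_eq {s t : HFree K A Ω X} (h : HRel C P s t) :
    HFree.toIsotopyQuotient C P s = HFree.toIsotopyQuotient C P t := by
  rw [HFree.toIsotopyQuotient, AlgHom.comp_apply, AlgHom.comp_apply, RingQuot.mkAlgHom_rel K h]

theorem HFree.toIsotopyQuotient_tgt (a : A) :
    HFree.toIsotopyQuotient C P (HFree.tgt K A Ω X (MulOpposite.op a)) =
      HFree.toIsotopyQuotient C P (HFree.src K A Ω X a) :=
  (RingQuot.mkAlgHom_rel K (IsoRel.eq (H := HAlg C P)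
    (s := HAlg.source C P) (t := HAlg.target C P) a)).symm

theorem HFree.src_mul_tgt (a : A) (a' : Aᵐᵒᵖ) :
    HFree.src K A Ω X a * HFree.tgt K A Ω X a' = HFree.tgt K A Ω X a' * HFree.src K A Ω X a := by
  unfold HFree.src HFree.tgt
  simp only [AlgHom.comp_apply]
  erw [← map_mul, ← map_mul]
  simp

/-- The generators of the isotopy quotient of `H𝔛` satisfy its relations. -/
theorem HAlg.isIsotopyModel :
    IsIsotopyModel (B := IsotopyAlg C P) C P
      ((HFree.toIsotopyQuotient C P).comp (HFree.src K A Ω X))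
      (HFree.vecRestrict (HFree.toIsotopyQuotient C P))
      (HFree.vecFormRestrict (HFree.toIsotopyQuotient C P))
      (HFree.formVecRestrict (HFree.toIsotopyQuotient C P)) where
  comm a b := by
    -- Commutativity is not imposed: source and target commute in `A^e`, and the isotopy quotient
    -- identifies them.
    have := congrArg (HFree.toIsotopyQuotient C P)
      (HFree.src_mul_tgt (Ω := Ω) (X := X) (K := K) a (MulOpposite.op b))
    rwa [map_mul, map_mul, HFree.toIsotopyQuotient_tgt] at this
  left_mul a v := by
    simpa [HFree.vecRestrict_apply] using HFree.toIsotopyQuotient_eq C P (.left_mul a v)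
  right_mul a v := by
    simpa [HFree.vecRestrict_apply] using HFree.toIsotopyQuotient_eq C P (.right_mul a v)
  bar_mul a v := by
    simpa [HFree.vecRestrict_apply, HFree.vecFormRestrict_apply, HFree.toIsotopyQuotient_tgt]
      using HFree.toIsotopyQuotient_eq C P (.bar_mul a v)
  vecForm_smul_left a v w := by
    simpa [HFree.vecFormRestrict_apply] using
      (HFree.toIsotopyQuotient_eq C P (.vecForm_bimod a 1 1 1 v w)).symm
  vecForm_op_smul_left a v w := by
    simpa [HFree.vecFormRestrict_apply] using
      (HFree.toIsotopyQuotient_eq C P (.vecForm_bimod 1 1 a 1 v w)).symm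
  vecForm_smul_right a v w := by
    simpa [HFree.vecFormRestrict_apply, HFree.toIsotopyQuotient_tgt] using
      (HFree.toIsotopyQuotient_eq C P (.vecForm_bimod 1 1 1 a v w)).symm
  vecForm_op_smul_right a v w := by
    simpa [HFree.vecFormRestrict_apply, HFree.toIsotopyQuotient_tgt] using
      (HFree.toIsotopyQuotient_eq C P (.vecForm_bimod 1 a 1 1 v w)).symm
  formVec_smul_left a w v := by
    simpa [HFree.formVecRestrict_apply] using
      (HFree.toIsotopyQuotient_eq C P (.formVec_bimod a 1 1 1 w v)).symm
  formVec_op_smul_left a w v := by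
    simpa [HFree.formVecRestrict_apply] using
      (HFree.toIsotopyQuotient_eq C P (.formVec_bimod 1 1 a 1 w v)).symm
  formVec_smul_right a w v := by
    simpa [HFree.formVecRestrict_apply, HFree.toIsotopyQuotient_tgt] using
      (HFree.toIsotopyQuotient_eq C P (.formVec_bimod 1 1 1 a w v)).symm
  formVec_op_smul_right a w v := by
    simpa [HFree.formVecRestrict_apply, HFree.toIsotopyQuotient_tgt] using
      (HFree.toIsotopyQuotient_eq C P (.formVec_bimod 1 a 1 1 w v)).symm
  inv_left v w := by
    simpa [HFree.formVecRestrict_apply, HFree.vecFormRestrict_apply, HFree.toIsotopyQuotient_tgt]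
      using HFree.toIsotopyQuotient_eq C P (.inv_left v w)
  inv_right v w := by
    simpa [HFree.formVecRestrict_apply, HFree.vecFormRestrict_apply]
      using HFree.toIsotopyQuotient_eq C P (.inv_right v w)
  hopf_left v w := by
    simpa [HFree.formVecRestrict_apply, HFree.vecFormRestrict_apply, HFree.toIsotopyQuotient_tgt]
      using HFree.toIsotopyQuotient_eq C P (.hopf_left v w)
  hopf_right v w := by
    simpa [HFree.formVecRestrict_apply, HFree.vecFormRestrict_apply]
      using HFree.toIsotopyQuotient_eq C P (.hopf_right v w)

variable {C P σ u F G}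

theorem IsIsotopyModel.exists_lift (h : IsIsotopyModel C P σ u F G) :
    ∃ f : IsotopyAlg C P →ₐ[K] B,
      (∀ a, f (HFree.toIsotopyQuotient C P (HFree.src K A Ω X a)) = σ a) ∧
      (∀ v, f (HFree.toIsotopyQuotient C P (HFree.vec K A v)) = u v) ∧
      (∀ v w, f (HFree.toIsotopyQuotient C P (HFree.vecForm K A v w)) = F v w) ∧
      (∀ w v, f (HFree.toIsotopyQuotient C P (HFree.formVec K A w v)) = G w v) := by
  have hrel : ∀ ⦃s t⦄, HRel C P s t →
      HFree.lift σ h.comm u F G s = HFree.lift σ h.comm u F G t := by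
    rintro _ _ (_ | _ | _ | ⟨a, a', b, b', v, w⟩ | ⟨a, a', b, b', w, v⟩ | ⟨v, w⟩ | ⟨v, w⟩ |
      ⟨v, w⟩ | ⟨v, w⟩)
    · simpa using h.left_mul _ _
    · simpa using h.right_mul _ _
    · simpa using h.bar_mul _ _
    · simp [h.vecForm_smul_left, h.vecForm_op_smul_left, h.vecForm_smul_right,
        h.vecForm_op_smul_right, mul_assoc, h.comm b']
    · simp [h.formVec_smul_left, h.formVec_op_smul_left, h.formVec_smul_right,
        h.formVec_op_smul_right, mul_assoc, h.comm b']
    · simpa using h.inv_left v w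
    · simpa using h.inv_right v w
    · simpa using h.hopf_left v w
    · simpa using h.hopf_right v w
  let f : HAlg C P →ₐ[K] B := RingQuot.liftAlgHom K ⟨HFree.lift σ h.comm u F G, hrel⟩
  have hf : ∀ t, f (RingQuot.mkAlgHom K (HRel C P) t) = HFree.lift σ h.comm u F G t := fun t =>
    RingQuot.liftAlgHom_mkAlgHom_apply K _ _ _
  have hiso : ∀ ⦃s t⦄, IsoRel (H := HAlg C P) (HAlg.source C P) (HAlg.target C P) s t →
      f s = f t := by
    rintro _ _ ⟨a⟩
    simp [HAlg.source, HAlg.target, hf]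
  refine ⟨RingQuot.liftAlgHom K ⟨f, hiso⟩, fun a => ?_, fun v => ?_, fun v w => ?_,
    fun w v => ?_⟩ <;>
  simp [HFree.toIsotopyQuotient, IsotopyQuotient.mk, hf]

theorem IsotopyQuotient.hom_ext
    {f g : IsotopyAlg C P →ₐ[K] B}
    (h₁ : ∀ a, f (HFree.toIsotopyQuotient C P (HFree.src K A Ω X a)) =
      g (HFree.toIsotopyQuotient C P (HFree.src K A Ω X a)))
    (h₂ : ∀ v, f (HFree.toIsotopyQuotient C P (HFree.vec K A v)) =
      g (HFree.toIsotopyQuotient C P (HFree.vec K A v)))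
    (h₃ : ∀ v w, f (HFree.toIsotopyQuotient C P (HFree.vecForm K A v w)) =
      g (HFree.toIsotopyQuotient C P (HFree.vecForm K A v w)))
    (h₄ : ∀ w v, f (HFree.toIsotopyQuotient C P (HFree.formVec K A w v)) =
      g (HFree.toIsotopyQuotient C P (HFree.formVec K A w v))) : f = g := by
  have h₅ : f.comp (HFree.toIsotopyQuotient C P) = g.comp (HFree.toIsotopyQuotient C P) :=
    HFree.hom_ext h₁ (fun a => by
      have := h₁ a.unop
      rwa [← HFree.toIsotopyQuotient_tgt] at this) h₂ h₃ h₄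
  refine RingQuot.ringQuot_ext' K f g (RingQuot.ringQuot_ext' K _ _ h₅)

end HAlgebra

end

end NCG

/-! ### The two mutually inverse algebra maps -/

open NCG in
theorem mainTheorem11 {K A Ω X : Type u} [Field K] [Ring A] [Algebra K A]
    [AddCommGroup Ω] [Module K Ω] [Module A Ω] [Module Aᵐᵒᵖ Ω]
    [IsScalarTower K A Ω] [IsScalarTower K Aᵐᵒᵖ Ω] [SMulCommClass A Aᵐᵒᵖ Ω]
    [AddCommGroup X] [Module K X] [Module A X] [Module Aᵐᵒᵖ X]
    [IsScalarTower K A X] [IsScalarTower K Aᵐᵒᵖ X] [SMulCommClass A Aᵐᵒᵖ X]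
    (C : Calculus K A Ω) (hC : C.Surjective) (P : Pivotal K A Ω X)
    {p q : ℕ} (b : Fin p → A) (x : Fin p → X) (y : Fin q → X) (c : Fin q → A)
    (hbx : ∑ i, btmul K A (C.d (b i)) (x i) = P.evl.coevOne)
    (hyc : ∑ j, btmul K A (y j) (C.d (c j)) = P.evr.coevOne) :
    ∃ φ : QAlg C P b x y c ≃ₐ[K] IsotopyQuotient (HAlg.source C P) (HAlg.target C P),
      (∀ a : A, φ (QAlg.mk C P b x y c (QFree.base K A X (Ab.mk K A a))) =
        IsotopyQuotient.mk _ _ (HAlg.source C P a)) ∧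
      (∀ v : X, φ (QAlg.mk C P b x y c (QFree.vec K A v)) =
        IsotopyQuotient.mk _ _ (HAlg.vec C P v)) ∧
      (∀ v : X, φ (QAlg.mk C P b x y c (QFree.bar K A v)) =
        IsotopyQuotient.mk _ _
          (∑ i, HAlg.formVec C P (P.evl.right i) v * HAlg.vec C P (P.evl.left i))) := by
  have hI := HAlg.isIsotopyModel C P
  have hQ := QAlg.isPresentationModel C P b x y c
  have hIQ := hI.isPresentationModel hbx hyc
  obtain ⟨f, hf₁, hf₂, hf₃⟩ := hIQ.exists_lift
  obtain ⟨F, hF⟩ := hQ.exists_vecForm hC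
  obtain ⟨G, hG⟩ := hQ.exists_formVec hC
  have hQI := hQ.isIsotopyModel hC hbx hyc hF hG
  obtain ⟨g, hg₁, hg₂, hg₃, hg₄⟩ := hQI.exists_lift
  have hgf : g.comp f = AlgHom.id K _ := by
    refine QAlg.hom_ext (B := QAlg C P b x y c) (f := g.comp f) (g := AlgHom.id K _)
      (fun a => ?_) (fun v => ?_) (fun v => ?_)
    · simp only [AlgHom.comp_apply, hf₁, hg₁, AlgHom.id_apply]; rfl
    · simp only [AlgHom.comp_apply, hf₂, HFree.vecRestrict_apply, hg₂, AlgHom.id_apply]; rfl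
    -- With the representative `∑ db_i ⊗ x_i`, the image of `v̄` involves only forms `db_i`, where
    -- `G` is a known commutator.
    · simp only [AlgHom.comp_apply, hf₃, hI.bar_eq_sum hbx, map_sum, map_mul,
        HFree.vecRestrict_apply, HFree.formVecRestrict_apply, hg₂, hg₄, AlgHom.id_apply]
      exact hQ.sum_formVec_mul_vec hG v
  have hfg : f.comp g = AlgHom.id K _ := by
    have hfu : ∀ v, f (QFree.vecRestrict (B := QAlg C P b x y c) (QAlg.mk C P b x y c) v) = _ := hf₂
    have hfw : ∀ v, f (QFree.barRestrict (B := QAlg C P b x y c) (QAlg.mk C P b x y c) v) = _ := hf₃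
    have hfσ : ∀ a, f (((QAlg.mk C P b x y c).comp ((QFree.base K A X).comp (Ab.mk K A))) a) = _ :=
      hf₁
    refine IsotopyQuotient.hom_ext (B := IsotopyAlg C P) (f := f.comp g)
      (g := AlgHom.id K _) (fun a => ?_) (fun v => ?_) (fun v w => ?_) (fun w v => ?_)
    · simp only [AlgHom.comp_apply, hg₁, AlgHom.id_apply]; exact hf₁ a
    · simp only [AlgHom.comp_apply, hg₂, AlgHom.id_apply]; exact hf₂ v
    · simp only [AlgHom.comp_apply, hg₃, AlgHom.id_apply]
      rw [← HFree.vecFormRestrict_apply]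
      -- `F` is characterised only on forms `(dr)s`; there both sides equal `s[v, r]` in the isotopy
      -- quotient.
      refine hC.ext_d_smul (f := fun w => f (F v w)) (by simp) (by simp) (fun r s => ?_) w
      rw [hF, map_mul, map_sub, map_mul, map_mul, hfu, hfσ, hfσ, hI.vecForm_op_smul_right,
        hI.bar_mul, add_sub_cancel_left]
    · simp only [AlgHom.comp_apply, hg₄, AlgHom.id_apply]
      rw [← HFree.formVecRestrict_apply]
      refine hC.ext_d_smul (f := fun w => f (G w v)) (g := fun w => HFree.formVecRestrict _ w v)
        (by simp) (by simp) (fun r s => ?_) w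
      rw [hG, map_mul, map_sub, map_mul, map_mul, hfw, hfσ, hfσ, hI.formVec_op_smul_left,
        hI.bar_mul_eq_add_formVec, add_sub_cancel_left]
  refine ⟨AlgEquiv.ofAlgHom f g hfg hgf, hf₁, hf₂, fun v => ?_⟩
  rw [AlgEquiv.ofAlgHom_apply, hf₃, IsIsotopyModel.bar_apply, map_sum]
  simp only [map_mul]
  rfl
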